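/- Let $(M,g)$ be a smooth Riemannian manifold without boundary (Hausdorff, second countable; no completeness, connectedness or curvature assumption), let $\phi:M\to\mathbf R$ be smooth, and let $\mathcal L_\phi v=\Delta v-\langle\nabla v,\nabla\phi\rangle$, acting componentwise on $v:M\to\mathbf R^N$, where $\Delta=\operatorname{div}\nabla$. All integrals are taken with respect to the Riemannian volume. Let $W^{1,2}_\phi$ be the closure of the smooth compactly supported functions $M\to\mathbf R^N$ in the norm $\|v\|_{W^{1,2}_\phi}^2=\int(|v|^2+|\nabla v|^2)\,e^{-\phi}$ (if $M$ is complete, this is the space of all Sobolev functions of finite norm). Let $a<b$ and let $u:M\times[a,b]\to\mathbf R^N$ be smooth and not identically zero, with $u(\cdot,t),\,u_t(\cdot,t)\in W^{1,2}_\phi$ for each $t\in[a,b]$, with $t\mapsto\|u(\cdot,t)\|_{W^{1,2}_\phi}$ bounded on $[a,b]$, and with $(\partial_t-\mathcal L_\phi)u=0$ on $M\times[a,b]$. Set $$I(t)=\int|u|^2e^{-\phi},\qquad D(t)=-\int|\nabla u|^2e^{-\phi},\qquad U(t)=\frac{D(t)}{I(t)} .$$ Then, with one-sided derivatives at the end points: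 1. $I>0$ and $D(t)=\int\langle u,\mathcal L_\phi u\rangle e^{-\phi}$ on $[a,b]$. 2. $\log I$ is differentiable on $[a,b]$ with $(\log I)'=2U$. 3. $\log I$ is convex on $[a,b]$; $U$ is differentiable on $[a,b]$ with $U'\ge 0$, and so $U$ is nondecreasing. 4. If $U$ is constant on $[a,b]$, then $u(x,t)=e^{U(t-s)}u(x,s)$ for all $x\in M$ and $s,t\in[a,b]$ (so $u(x,t)=e^{Ut}u(x,0)$ if $0\in[a,b]$), and each $u(\cdot,s)$ is an eigenfunction of $\mathcal L_\phi$ with eigenvalue $-U$, that is, $u(\cdot,s)\not\equiv0$ and $\mathcal L_\phi u(\cdot,s)=U\,u(\cdot,s)$. -/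

import Mathlib

open MeasureTheory Set
open scoped Manifold ContDiff ENNReal NNReal

noncomputable section

namespace DriftHeat

/-- The Euclidean space `ℝⁿ`, with its Euclidean norm and Lebesgue measure. -/
abbrev Euc (n : ℕ) : Type := EuclideanSpace ℝ (Fin n)

/-- A smooth Riemannian metric on a smooth `n`-manifold `M` (without boundary). -/
abbrev Metric (n : ℕ) (M : Type*) [TopologicalSpace M] [ChartedSpace (Euc n) M]
    [IsManifold 𝓘(ℝ, Euc n) ∞ M] :=
  Bundle.ContMDiffRiemannianMetric 𝓘(ℝ, Euc n) ∞ (Euc n)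
    (fun x : M => TangentSpace 𝓘(ℝ, Euc n) x)

section

variable {n : ℕ} {M : Type*} [TopologicalSpace M] [ChartedSpace (Euc n) M]
  [IsManifold 𝓘(ℝ, Euc n) ∞ M]

/-- The metric at `x` as a bilinear form on the tangent space. -/
def form (g : Metric n M) (x : M) : LinearMap.BilinForm ℝ (TangentSpace 𝓘(ℝ, Euc n) x) :=
  LinearMap.mk₂ ℝ (fun v w => g.inner x v w) (by simp) (by simp) (by simp) (by simp)

theorem form_nondegenerate (g : Metric n M) (x : M) : (form g x).Nondegenerate := by
  constructor
  · intro v hv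
    by_contra h
    exact (g.pos x v h).ne' (hv v)
  · intro v hv
    by_contra h
    exact (g.pos x v h).ne' (hv v)

instance (x : M) : FiniteDimensional ℝ (TangentSpace 𝓘(ℝ, Euc n) x) :=
  inferInstanceAs (FiniteDimensional ℝ (Euc n))

/-- The differential `df_x` of a real function, as a linear form on the tangent space. -/
def differential (f : M → ℝ) (x : M) : Module.Dual ℝ (TangentSpace 𝓘(ℝ, Euc n) x) :=
  (mfderiv 𝓘(ℝ, Euc n) 𝓘(ℝ, ℝ) f x).toLinearMap

/-- The gradient of a real function: the vector `∇f(x)` with `⟨∇f(x), v⟩ = df_x(v)`. -/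
def grad (g : Metric n M) (f : M → ℝ) (x : M) : TangentSpace 𝓘(ℝ, Euc n) x :=
  ((form g x).toDual (form_nondegenerate g x)).symm (differential f x)

theorem inner_grad (g : Metric n M) (f : M → ℝ) (x : M) (v : TangentSpace 𝓘(ℝ, Euc n) x) :
    g.inner x (grad g f x) v = mfderiv 𝓘(ℝ, Euc n) 𝓘(ℝ, ℝ) f x v :=
  LinearMap.congr_fun
    (((form g x).toDual (form_nondegenerate g x)).apply_symm_apply (differential f x)) v

/-- The `i`-th coordinate vector field of the chart at `p`, at the point with coordinates `z`. -/
def coordVec (p : M) (z : Euc n) (i : Fin n) :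
    TangentSpace 𝓘(ℝ, Euc n) ((chartAt (Euc n) p).symm z) :=
  mfderiv 𝓘(ℝ, Euc n) 𝓘(ℝ, Euc n) (chartAt (Euc n) p).symm z (EuclideanSpace.single i (1 : ℝ))

/-- The matrix `(g_ij)` of the metric in the chart at `p`, as a function of the coordinates. -/
def gram (g : Metric n M) (p : M) (z : Euc n) : Matrix (Fin n) (Fin n) ℝ :=
  Matrix.of fun i j => g.inner ((chartAt (Euc n) p).symm z) (coordVec p z i) (coordVec p z j)

/-- The volume density `√det(g_ij)` in the chart at `p`. -/
def density (g : Metric n M) (p : M) (z : Euc n) : ℝ := √(gram g p z).det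

/-- The representation in the chart at `p` of a vector field on `M`. -/
def coordRep (p : M) (X : (y : M) → TangentSpace 𝓘(ℝ, Euc n) y) (z : Euc n) : Euc n :=
  mfderiv 𝓘(ℝ, Euc n) 𝓘(ℝ, Euc n) (chartAt (Euc n) p) ((chartAt (Euc n) p).symm z)
    (X ((chartAt (Euc n) p).symm z))

/-- The Riemannian divergence `(1/√det g) ∑ ∂_i (√det g · Xⁱ)`, computed at `x` in the preferred
chart at `x`. -/
def divergence (g : Metric n M) (X : (y : M) → TangentSpace 𝓘(ℝ, Euc n) y) (x : M) : ℝ :=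
  (density g x (chartAt (Euc n) x x))⁻¹ *
    LinearMap.trace ℝ (Euc n)
      (fderiv ℝ (fun z => density g x z • coordRep x X z) (chartAt (Euc n) x x)).toLinearMap

/-- The Laplace–Beltrami operator `Δf = div ∇f`. -/
def laplacian (g : Metric n M) (f : M → ℝ) (x : M) : ℝ := divergence g (grad g f) x

/-- The drift Laplacian `L_φ f = Δf - ⟨∇f, ∇φ⟩`, acting componentwise on `ℝᴺ`-valued functions. -/
def driftLaplacian (g : Metric n M) (φ : M → ℝ) {N : ℕ} (f : M → Euc N) (x : M) : Euc N :=
  WithLp.toLp 2 fun k =>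
    laplacian g (fun y => f y k) x - g.inner x (grad g (fun y => f y k) x) (grad g φ x)

/-- `|∇f|²` for an `ℝᴺ`-valued function `f`. -/
def gradSq (g : Metric n M) {N : ℕ} (f : M → Euc N) (x : M) : ℝ :=
  ∑ k, g.inner x (grad g (fun y => f y k) x) (grad g (fun y => f y k) x)

/-- `f` is an eigenfunction of `L_φ` with eigenvalue `lam`, in the convention
`L_φ f + lam f = 0`, `f ≠ 0`. -/
def IsEigenfunction (g : Metric n M) (φ : M → ℝ) {N : ℕ} (f : M → Euc N) (lam : ℝ) : Prop :=
  f ≠ 0 ∧ ∀ x, driftLaplacian g φ f x = -(lam • f x)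

variable [MeasurableSpace M]

/-- The Riemannian volume of the preferred chart domain at `p`: the push-forward under the inverse
chart of `√det(g_ij) dz`. -/
def chartVolume (g : Metric n M) (p : M) : Measure M :=
  ((volume.restrict (chartAt (Euc n) p).target).withDensity
    fun z => ENNReal.ofReal (density g p z)).map (chartAt (Euc n) p).symm

/-- The Riemannian volume measure: the smallest measure dominating the measures `chartVolume g p`.
These agree on overlaps by the change of variables formula, so it is the unique measure whose
restriction to each chart domain is `√det(g_ij) dz`. -/
def riemVolume (g : Metric n M) : Measure M := ⨆ p : M, chartVolume g p

/-- The weighted volume `e^{-φ} dvol`. -/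
def weightedVolume (g : Metric n M) (φ : M → ℝ) : Measure M :=
  (riemVolume g).withDensity fun x => ENNReal.ofReal (Real.exp (-φ x))

/-- The squared Sobolev norm `∫ (|f|² + |∇f|²) e^{-φ}` of a smooth `f`, possibly infinite. -/
def sobolevSq (g : Metric n M) (φ : M → ℝ) {N : ℕ} (f : M → Euc N) : ℝ≥0∞ :=
  ∫⁻ x, ENNReal.ofReal (‖f x‖ ^ 2 + gradSq g f x) ∂(weightedVolume g φ)

/-- `f` is a smooth element of `W^{1,2}_φ`, the closure of the smooth compactly supported functions
in the norm `(∫ (|f|² + |∇f|²) e^{-φ})^{1/2}`. -/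
def MemSobolev (g : Metric n M) (φ : M → ℝ) {N : ℕ} (f : M → Euc N) : Prop :=
  ContMDiff 𝓘(ℝ, Euc n) 𝓘(ℝ, Euc N) ∞ f ∧
    ∀ ε : ℝ≥0∞, 0 < ε → ∃ ψ : M → Euc N,
      ContMDiff 𝓘(ℝ, Euc n) 𝓘(ℝ, Euc N) ∞ ψ ∧ HasCompactSupport ψ ∧
        sobolevSq g φ (fun x => f x - ψ x) < ε

/-- `I(t) = ∫ |u|² e^{-φ}`. -/
def energyI (g : Metric n M) (φ : M → ℝ) {N : ℕ} (u : M → ℝ → Euc N) (t : ℝ) : ℝ :=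
  ∫ x, ‖u x t‖ ^ 2 ∂(weightedVolume g φ)

/-- `D(t) = -∫ |∇u|² e^{-φ}`. -/
def energyD (g : Metric n M) (φ : M → ℝ) {N : ℕ} (u : M → ℝ → Euc N) (t : ℝ) : ℝ :=
  -∫ x, gradSq g (fun y => u y t) x ∂(weightedVolume g φ)

/-- The parabolic frequency `U = D / I`. -/
def frequency (g : Metric n M) (φ : M → ℝ) {N : ℕ} (u : M → ℝ → Euc N) (t : ℝ) : ℝ :=
  energyD g φ u t / energyI g φ u t

/-- The time derivative `u_t` on the interval `[a, b]` (one-sided at the end points). -/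
def timeDeriv (a b : ℝ) {N : ℕ} (u : M → ℝ → Euc N) (x : M) (t : ℝ) : Euc N :=
  derivWithin (fun s => u x s) (Icc a b) t

end

end DriftHeat

end

/-! On a closed manifold one integrates by parts to get `I' = 2D` and `D' = 2E` with `E = ∫ |u_t|²
e^{-φ}`. Since `D = ∫ ⟨u, u_t⟩ e^{-φ}`, the Cauchy–Schwarz inequality `D² ≤ I E` gives `(D/I)' = 2
(I E - D²) / I² ≥ 0`, and equality forces `u_t = c u`. Here `M` may be incomplete and nothing bounds
the norm of `u_t` uniformly in time, so `I` and `D` cannot simply be differentiated under the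
integral sign.

The remedy is to separate the two times. Put `f s t = ∫ ⟨u(s), u(t)⟩ e^{-φ}` and `k s t = ∫ ⟨u(s),
u_t(t)⟩ e^{-φ}`. Approximation by test functions extends Green's formula to the Sobolev space
(`MemSobolev.integral_inner_driftLaplacian`), so `k s t = -∫ ⟨∇u(s), ∇u(t)⟩ e^{-φ}` is symmetric.
For a fixed `w` in the Sobolev space, `∫ ⟨u(s), w⟩ e^{-φ}` has `s`-derivative `-∫ ⟨∇w, ∇u(s)⟩
e^{-φ}` (`hasDerivWithinAt_integral_inner`); only the bound on the norm of `u` enters. Taking `w =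
u(t)` gives `∂_s f = k`, and `w = u_t(t)` gives `∂_s k = ∫ ⟨u_t(s), u_t(t)⟩ e^{-φ}`.

By symmetry `∂_s f = ∂_t f`, so `f` depends only on `s + t`, as for a symmetric semigroup. Since `k`
is only known to be separately continuous, `eq_midpoint_of_symm` proves this for a primitive of `f`
first. The property passes to `k` (`deriv_eq_midpoint`), and differentiating along the diagonal
(`hasDerivWithinAt_diag`) gives `I' = 2D` and `D' = 2E`.

Positivity comes from the same source: `f s t = I((s+t)/2)` and Cauchy–Schwarz give `I((s+t)/2)² ≤
I(s) I(t)`, so zeros of `I` would accumulate at any point where `I ≠ 0` (`pos_of_sq_midpoint_le`).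

The geometric input is the divergence theorem `integral_mul_divergence`, which rests on chart
independence of the volume and of the divergence. -/

noncomputable section

namespace DriftHeat

/-! ### The metric and its volume density in charts. -/

section ChartGeometry

variable {n : ℕ} {M : Type*} [TopologicalSpace M] [ChartedSpace (Euc n) M]
  [IsManifold 𝓘(ℝ, Euc n) ∞ M]

theorem mdifferentiable_chart_smooth (p : M) :
    (chartAt (Euc n) p).MDifferentiable 𝓘(ℝ, Euc n) 𝓘(ℝ, Euc n) :=
  haveI : IsManifold 𝓘(ℝ, Euc n) 1 M := .of_le (n := ∞) (by simp)
  mdifferentiable_chart p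

/-- The derivative of the inverse chart at `p`. -/
def chartFrame (p : M) (z : Euc n) :
    Euc n →L[ℝ] TangentSpace 𝓘(ℝ, Euc n) ((chartAt (Euc n) p).symm z) :=
  mfderiv 𝓘(ℝ, Euc n) 𝓘(ℝ, Euc n) (chartAt (Euc n) p).symm z

/-- The derivative of the chart at `p`, at the point with coordinates `z`. -/
def chartCoframe (p : M) (z : Euc n) :
    TangentSpace 𝓘(ℝ, Euc n) ((chartAt (Euc n) p).symm z) →L[ℝ] Euc n :=
  mfderiv 𝓘(ℝ, Euc n) 𝓘(ℝ, Euc n) (chartAt (Euc n) p) ((chartAt (Euc n) p).symm z)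

theorem chartCoframe_chartFrame {p : M} {z : Euc n} (hz : z ∈ (chartAt (Euc n) p).target)
    (v : Euc n) : chartCoframe p z (chartFrame p z v) = v :=
  congrArg (fun L : Euc n →L[ℝ] Euc n => L v)
    ((mdifferentiable_chart_smooth p).comp_symm_deriv hz)

theorem chartFrame_chartCoframe {p : M} {z : Euc n} (hz : z ∈ (chartAt (Euc n) p).target)
    (v : TangentSpace 𝓘(ℝ, Euc n) ((chartAt (Euc n) p).symm z)) :
    chartFrame p z (chartCoframe p z v) = v := by
  have h := (mdifferentiable_chart_smooth p).symm_comp_deriv ((chartAt (Euc n) p).map_target hz)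
  -- The two base points `z` and `chart (chart.symm z)` agree only propositionally; generalising
  -- over `z'` allows substitution under the dependent types.
  have aux : ∀ z' : Euc n, z' = chartAt (Euc n) p ((chartAt (Euc n) p).symm z) →
      (mfderiv 𝓘(ℝ, Euc n) 𝓘(ℝ, Euc n) (chartAt (Euc n) p).symm z' : Euc n →L[ℝ] Euc n).comp
        (mfderiv 𝓘(ℝ, Euc n) 𝓘(ℝ, Euc n) (chartAt (Euc n) p) ((chartAt (Euc n) p).symm z) :
          Euc n →L[ℝ] Euc n) = ContinuousLinearMap.id ℝ (Euc n) := by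
    rintro _ rfl
    exact h
  exact congrArg (fun L : Euc n →L[ℝ] Euc n => L v) (aux z ((chartAt (Euc n) p).right_inv hz).symm)

/-- The metric read in the chart at `p`. -/
def localForm (g : Metric n M) (p : M) (z : Euc n) : LinearMap.BilinForm ℝ (Euc n) :=
  (form g ((chartAt (Euc n) p).symm z)).comp (chartFrame p z).toLinearMap
    (chartFrame p z).toLinearMap

theorem localForm_apply (g : Metric n M) (p : M) (z v w : Euc n) :
    localForm g p z v w =
      g.inner ((chartAt (Euc n) p).symm z) (chartFrame p z v) (chartFrame p z w) := rfl

/-- The standard basis of `Euc n`. -/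
abbrev stdBasis (n : ℕ) : Module.Basis (Fin n) ℝ (Euc n) := (EuclideanSpace.basisFun (Fin n) ℝ).toBasis

theorem gram_eq_toMatrix (g : Metric n M) (p : M) (z : Euc n) :
    gram g p z = LinearMap.BilinForm.toMatrix (stdBasis n) (localForm g p z) := by
  ext i j
  simp [gram, LinearMap.BilinForm.toMatrix_apply, localForm_apply, coordVec, chartFrame]
  rfl

theorem localForm_pos (g : Metric n M) {p : M} {z : Euc n} (hz : z ∈ (chartAt (Euc n) p).target)
    {v : Euc n} (hv : v ≠ 0) : 0 < localForm g p z v v := by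
  refine g.pos _ _ fun h => hv ?_
  have h2 := congrArg (chartCoframe p z) h
  rw [map_zero] at h2
  exact (chartCoframe_chartFrame hz v).symm.trans h2

theorem gram_posDef (g : Metric n M) {p : M} {z : Euc n} (hz : z ∈ (chartAt (Euc n) p).target) :
    (gram g p z).PosDef := by
  refine Matrix.PosDef.of_dotProduct_mulVec_pos ?_ fun x hx => ?_
  · ext i j
    simp [gram, g.symm]
  · have h := localForm_pos g hz (v := WithLp.toLp 2 x) (by simpa using hx)
    rw [LinearMap.BilinForm.apply_eq_dotProduct_toMatrix_mulVec (stdBasis n),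
      ← gram_eq_toMatrix] at h
    exact h

/-- The frame fields are the tangent map of the inverse chart applied to constant fields, hence
smooth sections along it; the smooth bundle metric is then evaluated on two of them. -/
theorem contDiffOn_localForm (g : Metric n M) (p : M) (v w : Euc n) :
    ContDiffOn ℝ ∞ (fun z => localForm g p z v w) (chartAt (Euc n) p).target := by
  have key : ∀ v : Euc n, ContMDiffOn 𝓘(ℝ, Euc n) (𝓘(ℝ, Euc n).prod 𝓘(ℝ, Euc n)) ∞
      (fun z => Bundle.TotalSpace.mk' (Euc n) (E := TangentSpace 𝓘(ℝ, Euc n))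
        ((chartAt (Euc n) p).symm z) (chartFrame p z v)) (chartAt (Euc n) p).target := by
    intro v
    have h := (contMDiffOn_chart_symm (I := 𝓘(ℝ, Euc n)) (x := p) (n := ∞)).contMDiffOn_tangentMapWithin
      (m := ∞) (by simp) (chartAt (Euc n) p).open_target.uniqueMDiffOn
    have h2 : ContMDiff 𝓘(ℝ, Euc n) (𝓘(ℝ, Euc n).prod 𝓘(ℝ, Euc n)) ∞
        (fun z : Euc n => (Bundle.TotalSpace.mk' (Euc n) (E := TangentSpace 𝓘(ℝ, Euc n)) z v)) := by
      exact contMDiff_vectorSpace_iff_contDiff.2 contDiff_const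
    refine (h.comp h2.contMDiffOn (fun z hz => hz)).congr fun z hz => ?_
    simp [tangentMapWithin, chartFrame, mfderivWithin_of_isOpen (chartAt (Euc n) p).open_target hz]
    rfl
  intro z hz
  have := ContMDiffWithinAt.clm_bundle_apply₂ (F₁ := Euc n) (F₂ := Euc n)
    (E₁ := TangentSpace 𝓘(ℝ, Euc n)) (E₂ := TangentSpace 𝓘(ℝ, Euc n)) (F₃ := ℝ)
    (E₃ := Bundle.Trivial M ℝ) (b := (chartAt (Euc n) p).symm)
    (ψ := fun z => g.inner ((chartAt (Euc n) p).symm z))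
    (v := fun z => chartFrame p z v) (w := fun z => chartFrame p z w)
    (ContMDiffAt.comp_contMDiffWithinAt z g.contMDiff.contMDiffAt
      (contMDiffOn_chart_symm (I := 𝓘(ℝ, Euc n)) (x := p) z hz)) (key v z hz) (key w z hz)
  simp only [Bundle.contMDiffWithinAt_totalSpace] at this
  exact this.2.contDiffWithinAt

theorem contDiffOn_gram (g : Metric n M) (p : M) (i j : Fin n) :
    ContDiffOn ℝ ∞ (fun z => gram g p z i j) (chartAt (Euc n) p).target :=
  contDiffOn_localForm g p _ _

theorem _root_.ContDiffOn.matrix_det {E : Type*} [NormedAddCommGroup E] [NormedSpace ℝ E]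
    {m : Type*} [Fintype m] [DecidableEq m] {A : E → Matrix m m ℝ} {s : Set E} {k : WithTop ℕ∞}
    (hA : ∀ i j, ContDiffOn ℝ k (fun z => A z i j) s) : ContDiffOn ℝ k (fun z => (A z).det) s := by
  simp only [Matrix.det_apply]
  refine ContDiffOn.sum fun σ _ => ContDiffOn.const_smul _ ?_
  exact contDiffOn_prod fun i _ => hA _ _

theorem _root_.ContDiffOn.matrix_inv {E : Type*} [NormedAddCommGroup E] [NormedSpace ℝ E]
    {m : Type*} [Fintype m] [DecidableEq m] {A : E → Matrix m m ℝ} {s : Set E} {k : WithTop ℕ∞}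
    (hA : ∀ i j, ContDiffOn ℝ k (fun z => A z i j) s) (hdet : ∀ z ∈ s, (A z).det ≠ 0) (i j : m) :
    ContDiffOn ℝ k (fun z => (A z)⁻¹ i j) s := by
  simp only [Matrix.inv_def, Ring.inverse_eq_inv', Matrix.smul_apply, Matrix.adjugate_apply,
    smul_eq_mul]
  refine ((ContDiffOn.matrix_det hA).inv hdet).mul (ContDiffOn.matrix_det fun i' j' => ?_)
  simp only [Matrix.updateRow_apply]
  split_ifs
  · exact contDiffOn_const
  · exact hA _ _

theorem gram_det_pos (g : Metric n M) {p : M} {z : Euc n} (hz : z ∈ (chartAt (Euc n) p).target) :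
    0 < (gram g p z).det := (gram_posDef g hz).det_pos

theorem density_pos (g : Metric n M) {p : M} {z : Euc n} (hz : z ∈ (chartAt (Euc n) p).target) :
    0 < density g p z := Real.sqrt_pos.2 (gram_det_pos g hz)

theorem contDiffOn_density (g : Metric n M) (p : M) :
    ContDiffOn ℝ ∞ (density g p) (chartAt (Euc n) p).target :=
  (ContDiffOn.matrix_det (contDiffOn_gram g p)).sqrt fun _ hz => (gram_det_pos g hz).ne'

/-- The transition map from the chart at `p` to the chart at `q`. -/
abbrev transition (p q : M) : Euc n → Euc n := chartAt (Euc n) q ∘ (chartAt (Euc n) p).symm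

/-- The part of the target of the chart at `p` over the domain of the chart at `q`. -/
abbrev overlap (n : ℕ) {M : Type*} [TopologicalSpace M] [ChartedSpace (Euc n) M] (p q : M) :
    Set (Euc n) :=
  (chartAt (Euc n) p).target ∩ (chartAt (Euc n) p).symm ⁻¹' (chartAt (Euc n) q).source

omit [IsManifold 𝓘(ℝ, Euc n) ∞ M] in
theorem isOpen_overlap (p q : M) : IsOpen (overlap n p q) :=
  (chartAt (Euc n) p).isOpen_inter_preimage_symm (chartAt (Euc n) q).open_source

theorem contDiffOn_transition (p q : M) : ContDiffOn ℝ ∞ (transition (n := n) p q) (overlap n p q) := by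
  rw [← contMDiffOn_iff_contDiffOn]
  exact (contMDiffOn_chart (I := 𝓘(ℝ, Euc n)) (x := q) (n := ∞)).comp
    ((contMDiffOn_chart_symm (I := 𝓘(ℝ, Euc n)) (x := p) (n := ∞)).mono inter_subset_left)
    inter_subset_right

theorem chartFrame_eq_transition {p q : M} {z : Euc n} (hz : z ∈ overlap n p q) (v : Euc n) :
    (chartFrame p z v : Euc n) = (chartFrame q (transition p q z) (fderiv ℝ (transition p q) z v) : Euc n) := by
  have hd : MDifferentiableAt 𝓘(ℝ, Euc n) 𝓘(ℝ, Euc n) (transition (n := n) p q) z :=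
    (((contDiffOn_transition p q).contDiffAt ((isOpen_overlap p q).mem_nhds hz)).differentiableAt
      (by simp)).mdifferentiableAt
  have hq : transition p q z ∈ (chartAt (Euc n) q).target := (chartAt (Euc n) q).map_source hz.2
  have hc := mfderiv_comp z ((mdifferentiable_chart_smooth q).mdifferentiableAt_symm hq) hd
  have he : (chartAt (Euc n) p).symm =ᶠ[nhds z] (chartAt (Euc n) q).symm ∘ transition p q := by
    filter_upwards [(isOpen_overlap p q).mem_nhds hz] with y hy
    simp [(chartAt (Euc n) q).left_inv hy.2]
  have h2 := he.mfderiv_eq (I := 𝓘(ℝ, Euc n)) (I' := 𝓘(ℝ, Euc n))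
  have h3 : (mfderiv 𝓘(ℝ, Euc n) 𝓘(ℝ, Euc n) (chartAt (Euc n) p).symm z : Euc n →L[ℝ] Euc n) =
    (mfderiv 𝓘(ℝ, Euc n) 𝓘(ℝ, Euc n) (chartAt (Euc n) q).symm (transition p q z) : Euc n →L[ℝ] Euc n).comp
      (fderiv ℝ (transition p q) z) := by
    have h4 := mfderiv_eq_fderiv (𝕜 := ℝ) (f := transition (n := n) p q) (x := z)
    exact h2.trans (hc.trans (congrArg (fun L : Euc n →L[ℝ] Euc n =>
      (mfderiv 𝓘(ℝ, Euc n) 𝓘(ℝ, Euc n) (chartAt (Euc n) q).symm (transition p q z) :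
        Euc n →L[ℝ] Euc n).comp L) h4))
  exact congrArg (fun L : Euc n →L[ℝ] Euc n => L v) h3

theorem localForm_eq_transition (g : Metric n M) {p q : M} {z : Euc n} (hz : z ∈ overlap n p q) :
    localForm g p z = (localForm g q (transition p q z)).comp
      (fderiv ℝ (transition p q) z).toLinearMap (fderiv ℝ (transition p q) z).toLinearMap := by
  have hx : (chartAt (Euc n) q).symm (transition p q z) = (chartAt (Euc n) p).symm z := by
    simp [(chartAt (Euc n) q).left_inv hz.2]
  have aux : ∀ x y : M, x = y → ∀ v w : Euc n,
      g.inner x (v : TangentSpace 𝓘(ℝ, Euc n) x) (w : TangentSpace 𝓘(ℝ, Euc n) x) =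
      g.inner y (v : TangentSpace 𝓘(ℝ, Euc n) y) (w : TangentSpace 𝓘(ℝ, Euc n) y) := by
    rintro x _ rfl v w; rfl
  ext v w
  change g.inner _ _ _ = g.inner _ _ _
  refine Eq.trans ?_ (aux _ _ hx.symm _ _)
  exact congrArg₂ (fun v w : Euc n => g.inner ((chartAt (Euc n) p).symm z)
    (v : TangentSpace 𝓘(ℝ, Euc n) ((chartAt (Euc n) p).symm z)) w)
    (chartFrame_eq_transition hz v) (chartFrame_eq_transition hz w)

/-- The metric matrix changes by congruence with the Jacobian `A` of the transition map, so its
determinant gains `det A ^ 2`. The resulting `|det A|` is exactly the factor in the change of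
variables formula. -/
theorem density_eq_transition (g : Metric n M) {p q : M} {z : Euc n} (hz : z ∈ overlap n p q) :
    density g p z = |(fderiv ℝ (transition p q) z).det| * density g q (transition p q z) := by
  rw [density, density, gram_eq_toMatrix, gram_eq_toMatrix, localForm_eq_transition g hz,
    LinearMap.BilinForm.toMatrix_comp (stdBasis n) (stdBasis n), Matrix.det_mul, Matrix.det_mul,
    Matrix.det_transpose, LinearMap.det_toMatrix, mul_comm _ (LinearMap.det _), ← mul_assoc,
    Real.sqrt_mul (mul_self_nonneg _), Real.sqrt_mul_self_eq_abs]

end ChartGeometry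

/-! ### The Riemannian volume and the weighted volume. -/

section Volume

variable {n : ℕ} {M : Type*} [TopologicalSpace M] [ChartedSpace (Euc n) M]
  [IsManifold 𝓘(ℝ, Euc n) ∞ M] [MeasurableSpace M] [BorelSpace M]

omit [IsManifold 𝓘(ℝ, Euc n) ∞ M] in
theorem aemeasurable_chart_symm (p : M) (f : Euc n → ℝ≥0∞) :
    AEMeasurable (chartAt (Euc n) p).symm
      ((volume.restrict (chartAt (Euc n) p).target).withDensity f) :=
  ((chartAt (Euc n) p).continuousOn_symm.aemeasurable
    (chartAt (Euc n) p).open_target.measurableSet).mono_ac (withDensity_absolutelyContinuous _ _)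

omit [MeasurableSpace M] [BorelSpace M] in
theorem aemeasurable_density (g : Metric n M) (p : M) :
    AEMeasurable (density g p) (volume.restrict (chartAt (Euc n) p).target) :=
  (contDiffOn_density g p).continuousOn.aemeasurable (chartAt (Euc n) p).open_target.measurableSet

theorem chartVolume_apply (g : Metric n M) (p : M) {A : Set M} (hA : MeasurableSet A) :
    chartVolume g p A =
      ∫⁻ z in (chartAt (Euc n) p).target ∩ (chartAt (Euc n) p).symm ⁻¹' A,
        ENNReal.ofReal (density g p z) := by
  rw [chartVolume, Measure.map_apply_of_aemeasurable (aemeasurable_chart_symm p _) hA,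
    withDensity_apply', Measure.restrict_restrict'
      (chartAt (Euc n) p).open_target.measurableSet, inter_comm]

theorem chartVolume_compl_source (g : Metric n M) (p : M) :
    chartVolume g p (chartAt (Euc n) p).sourceᶜ = 0 := by
  rw [chartVolume_apply g p (chartAt (Euc n) p).open_source.measurableSet.compl]
  have : (chartAt (Euc n) p).target ∩ (chartAt (Euc n) p).symm ⁻¹' (chartAt (Euc n) p).sourceᶜ = ∅ := by
    ext z
    simp only [mem_inter_iff, mem_preimage, mem_compl_iff, mem_empty_iff_false, iff_false, not_and,
      not_not]
    exact (chartAt (Euc n) p).map_target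
  rw [this, Measure.restrict_empty, lintegral_zero_measure]

theorem integral_chartVolume (g : Metric n M) (p : M) {F : M → ℝ}
    (hF : AEStronglyMeasurable F (chartVolume g p)) :
    ∫ x, F x ∂(chartVolume g p) =
      ∫ z in (chartAt (Euc n) p).target, density g p z * F ((chartAt (Euc n) p).symm z) := by
  rw [chartVolume, integral_map (aemeasurable_chart_symm p _) hF,
    integral_withDensity_eq_integral_toReal_smul₀ (aemeasurable_density g p).ennreal_ofReal (by simp)]
  refine integral_congr_ae (.of_forall fun z => ?_)
  have h : 0 ≤ density g p z := Real.sqrt_nonneg _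
  simp only [smul_eq_mul, ENNReal.toReal_ofReal h]

/-- Change of variables along the transition map, whose Jacobian is absorbed by
`density_eq_transition`. -/
theorem chartVolume_eq_of_subset (g : Metric n M) {p q : M} {A : Set M} (hA : MeasurableSet A)
    (hp : A ⊆ (chartAt (Euc n) p).source) (hq : A ⊆ (chartAt (Euc n) q).source) :
    chartVolume g p A = chartVolume g q A := by
  rw [chartVolume_apply g p hA, chartVolume_apply g q hA]
  set S : Set (Euc n) := (chartAt (Euc n) p).target ∩ (chartAt (Euc n) p).symm ⁻¹' A with hS
  have hSo : S ⊆ overlap n p q := fun z hz => ⟨hz.1, hq hz.2⟩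
  have hSm : MeasurableSet S := by
    have : S = Subtype.val '' ((fun z : (chartAt (Euc n) p).target =>
        (chartAt (Euc n) p).symm z) ⁻¹' A) := by
      ext z
      simp [hS, and_comm]
    rw [this]
    refine (chartAt (Euc n) p).open_target.measurableSet.subtype_image ?_
    exact (continuousOn_iff_continuous_domRestrict.1
      (chartAt (Euc n) p).continuousOn_symm).measurable hA
  have himg : (chartAt (Euc n) q).target ∩ (chartAt (Euc n) q).symm ⁻¹' A = transition p q '' S := by
    ext w
    constructor
    · rintro ⟨hw, hwA⟩
      refine ⟨chartAt (Euc n) p ((chartAt (Euc n) q).symm w), ⟨(chartAt (Euc n) p).map_source (hp hwA),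
        ?_⟩, ?_⟩
      · simpa [(chartAt (Euc n) p).left_inv (hp hwA)] using hwA
      · simp [(chartAt (Euc n) p).left_inv (hp hwA), (chartAt (Euc n) q).right_inv hw]
    · rintro ⟨z, hz, rfl⟩
      refine ⟨(chartAt (Euc n) q).map_source (hSo hz).2, ?_⟩
      simpa [(chartAt (Euc n) q).left_inv (hSo hz).2] using hz.2
  have hinj : InjOn (transition (n := n) p q) S := fun z hz w hw h =>
    (chartAt (Euc n) p).symm.injOn hz.1 hw.1
      ((chartAt (Euc n) q).injOn (hSo hz).2 (hSo hw).2 h)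
  have hd : ∀ z ∈ S, HasFDerivWithinAt (transition (n := n) p q) (fderiv ℝ (transition p q) z) S z :=
    fun z hz => (((contDiffOn_transition p q).contDiffAt
      ((isOpen_overlap p q).mem_nhds (hSo hz))).differentiableAt
        (by simp)).hasFDerivAt.hasFDerivWithinAt
  rw [himg, lintegral_image_eq_lintegral_abs_det_fderiv_mul volume hSm hd hinj]
  refine setLIntegral_congr_fun hSm fun z hz => ?_
  rw [density_eq_transition g (hSo hz), ENNReal.ofReal_mul (abs_nonneg _)]

/-- The Riemannian volume restricts to `chartVolume` on each chart domain. -/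
theorem riemVolume_restrict_source [SecondCountableTopology M] (g : Metric n M) (q : M) :
    (riemVolume g).restrict (chartAt (Euc n) q).source = chartVolume g q := by
  obtain ⟨s, hs, hcov⟩ := TopologicalSpace.countable_cover_nhds
    (fun x : M => (chartAt (Euc n) x).open_source.mem_nhds (mem_chart_source (Euc n) x))
  have hne : s.Nonempty := by
    by_contra h
    rw [not_nonempty_iff_eq_empty.1 h] at hcov
    have := hcov.symm ▸ mem_univ q
    simp at this
  obtain ⟨c, rfl⟩ := hs.exists_eq_range hne
  set D : ℕ → Set M := disjointed fun i => (chartAt (Euc n) (c i)).source with hD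
  have hDm : ∀ i, MeasurableSet (D i) := fun i =>
    MeasurableSet.disjointed (fun i => (chartAt (Euc n) (c i)).open_source.measurableSet) i
  have hDs : ∀ i, D i ⊆ (chartAt (Euc n) (c i)).source := fun i => disjointed_subset _ i
  have hDd : Pairwise (Function.onFun Disjoint D) := disjoint_disjointed _
  have hDU : ⋃ i, D i = univ := by
    rw [hD, iUnion_disjointed]
    simpa using hcov
  -- The chart measures are glued along a countable chart cover made disjoint. Each `chartVolume g
  -- p` agrees with `μ₀` inside its domain and vanishes outside, so the supremum `riemVolume g` is
  -- squeezed between `chartVolume g q` and `μ₀`.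
  set μ₀ : Measure M := Measure.sum fun i => (chartVolume g (c i)).restrict (D i) with hμ₀
  have key : ∀ p : M, ∀ A : Set M, MeasurableSet A → A ⊆ (chartAt (Euc n) p).source →
      chartVolume g p A = μ₀ A := by
    intro p A hA hAp
    have : chartVolume g p A = ∑' i, chartVolume g p (A ∩ D i) := by
      rw [← measure_iUnion (fun i j hij => ((hDd hij).inter_left' A).inter_right' A)
        (fun i => hA.inter (hDm i)), ← inter_iUnion, hDU, inter_univ]
    rw [this, hμ₀, Measure.sum_apply _ hA]
    refine tsum_congr fun i => ?_
    rw [Measure.restrict_apply hA]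
    exact chartVolume_eq_of_subset g (hA.inter (hDm i)) (inter_subset_left.trans hAp)
      (inter_subset_right.trans (hDs i))
  have hle : ∀ p : M, chartVolume g p ≤ μ₀ := by
    intro p
    refine Measure.le_iff.2 fun A hA => ?_
    rw [← measure_inter_add_sdiff A (chartAt (Euc n) p).open_source.measurableSet,
      measure_mono_null (sdiff_subset_compl A _) (chartVolume_compl_source g p), add_zero,
      key p _ (hA.inter (chartAt (Euc n) p).open_source.measurableSet) inter_subset_right]
    exact measure_mono inter_subset_left
  have h1 : riemVolume g ≤ μ₀ := iSup_le hle
  have h2 : chartVolume g q ≤ riemVolume g := le_iSup (chartVolume g) q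
  ext A hA
  have hAq := hA.inter (chartAt (Euc n) q).open_source.measurableSet
  have h3 : chartVolume g q A = chartVolume g q (A ∩ (chartAt (Euc n) q).source) := by
    rw [← measure_inter_add_sdiff A (chartAt (Euc n) q).open_source.measurableSet,
      measure_mono_null (sdiff_subset_compl A _) (chartVolume_compl_source g q), add_zero]
  rw [Measure.restrict_apply hA, h3]
  refine le_antisymm ?_ (h2 _)
  rw [key q _ hAq inter_subset_right]
  exact h1 _

theorem integral_riemVolume_of_support [SecondCountableTopology M] (g : Metric n M) (p : M) {F : M → ℝ}
    (hF : AEStronglyMeasurable F (chartVolume g p))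
    (hs : Function.support F ⊆ (chartAt (Euc n) p).source) :
    ∫ x, F x ∂(riemVolume g) =
      ∫ z in (chartAt (Euc n) p).target, density g p z * F ((chartAt (Euc n) p).symm z) := by
  rw [← setIntegral_eq_integral_of_forall_compl_eq_zero
    (fun x hx => Function.notMem_support.1 fun h => hx (hs h)), riemVolume_restrict_source,
    integral_chartVolume g p hF]

theorem isLocallyFiniteMeasure_riemVolume [SecondCountableTopology M] (g : Metric n M) :
    IsLocallyFiniteMeasure (riemVolume g) := by
  refine ⟨fun x => ?_⟩
  set e := chartAt (Euc n) x
  have hx : e x ∈ e.target := e.map_source (mem_chart_source (Euc n) x)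
  obtain ⟨r, hr, hball⟩ := Metric.nhds_basis_closedBall.mem_iff.1 (e.open_target.mem_nhds hx)
  have hV : e.source ∩ e ⁻¹' (Metric.ball (e x) r) ∈ nhds x :=
    e.continuousAt (mem_chart_source (Euc n) x) |>.preimage_mem_nhds (Metric.ball_mem_nhds _ hr)
      |> Filter.inter_mem (e.open_source.mem_nhds (mem_chart_source (Euc n) x))
  have hVo : IsOpen (e.source ∩ e ⁻¹' (Metric.ball (e x) r)) := e.isOpen_inter_preimage Metric.isOpen_ball
  refine ⟨_, hV, ?_⟩
  have h1 : riemVolume g (e.source ∩ e ⁻¹' (Metric.ball (e x) r)) =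
      chartVolume g x (e.source ∩ e ⁻¹' (Metric.ball (e x) r)) := by
    rw [← riemVolume_restrict_source, Measure.restrict_apply hVo.measurableSet,
      inter_eq_left.2 inter_subset_left]
  rw [h1, chartVolume_apply g x hVo.measurableSet]
  have h2 : e.target ∩ e.symm ⁻¹' (e.source ∩ e ⁻¹' (Metric.ball (e x) r)) ⊆
      Metric.closedBall (e x) r := by
    rintro z ⟨hz, -, hz2⟩
    rw [mem_preimage, e.right_inv hz] at hz2
    exact Metric.ball_subset_closedBall hz2
  refine (lintegral_mono_set h2).trans_lt ?_
  have hi : IntegrableOn (density g x) (Metric.closedBall (e x) r) :=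
    ((contDiffOn_density g x).continuousOn.mono hball).integrableOn_compact (isCompact_closedBall _ _)
  exact hi.lintegral_lt_top

/-- Full support upgrades almost everywhere identities between continuous functions to identities
everywhere. It serves the chart independence of the divergence and, through the weighted version,
the positivity of `I` and the equality case of Cauchy–Schwarz. -/
theorem isOpenPosMeasure_riemVolume [SecondCountableTopology M] (g : Metric n M) :
    (riemVolume g).IsOpenPosMeasure := by
  refine ⟨fun U hU ⟨x, hx⟩ h0 => ?_⟩
  set e := chartAt (Euc n) x
  have h1 : chartVolume g x U = 0 := le_antisymm (h0 ▸ (le_iSup (chartVolume g) x) U) zero_le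
  rw [chartVolume_apply g x hU.measurableSet] at h1
  have hW : IsOpen (e.target ∩ e.symm ⁻¹' U) := e.isOpen_inter_preimage_symm hU
  have hne : (e.target ∩ e.symm ⁻¹' U).Nonempty :=
    ⟨e x, e.map_source (mem_chart_source (Euc n) x),
      by simpa [e, (chartAt (Euc n) x).left_inv (mem_chart_source (Euc n) x)] using hx⟩
  rw [lintegral_eq_zero_iff' ((aemeasurable_density g x).mono_measure
    (Measure.restrict_mono inter_subset_left le_rfl)).ennreal_ofReal] at h1
  have h2 : volume (e.target ∩ e.symm ⁻¹' U) = 0 := by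
    have h3 := (ae_restrict_iff' hW.measurableSet).1 h1
    refine measure_mono_null (fun z hz => ?_) (ae_iff.1 h3)
    simpa [hz.1, show e.symm z ∈ U from hz.2] using density_pos g hz.1
  exact hW.measure_ne_zero volume hne h2

theorem isLocallyFiniteMeasure_weightedVolume [SecondCountableTopology M] (g : Metric n M)
    {φ : M → ℝ} (hφ : Continuous φ) : IsLocallyFiniteMeasure (weightedVolume g φ) :=
  have := isLocallyFiniteMeasure_riemVolume g
  IsLocallyFiniteMeasure.withDensity_ofReal (Real.continuous_exp.comp hφ.neg)

theorem isOpenPosMeasure_weightedVolume [SecondCountableTopology M] (g : Metric n M)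
    {φ : M → ℝ} (hφ : Continuous φ) : (weightedVolume g φ).IsOpenPosMeasure := by
  have := isOpenPosMeasure_riemVolume g
  refine (withDensity_absolutelyContinuous' ?_ (.of_forall fun x => ?_)).isOpenPosMeasure
  · exact ((Real.continuous_exp.comp hφ.neg).measurable.ennreal_ofReal).aemeasurable
  · simp [Real.exp_pos]

omit [BorelSpace M] in
theorem integral_weightedVolume [OpensMeasurableSpace M] (g : Metric n M)
    {φ : M → ℝ} (hφ : Continuous φ) (F : M → ℝ) :
    ∫ x, F x ∂(weightedVolume g φ) = ∫ x, Real.exp (-φ x) * F x ∂(riemVolume g) := by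
  rw [weightedVolume, integral_withDensity_eq_integral_toReal_smul₀
    (f := fun x => ENNReal.ofReal (Real.exp (-φ x))) ((Real.continuous_exp.comp hφ.neg).measurable.ennreal_ofReal).aemeasurable (by simp)]
  refine integral_congr_ae (.of_forall fun z => ?_)
  simp [ENNReal.toReal_ofReal (Real.exp_pos _).le]

end Volume

/-- Integration by parts in Euclidean space against a test function supported in an open set. -/
theorem integral_mul_trace_fderiv {n : ℕ} {Ω : Set (Euc n)} (hΩ : IsOpen Ω) {ψ : Euc n → ℝ}
    (hψ : ContDiff ℝ 1 ψ) (hc : HasCompactSupport ψ) (hs : tsupport ψ ⊆ Ω) {V : Euc n → Euc n}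
    (hV : ContDiffOn ℝ 1 V Ω) :
    ∫ z, ψ z * LinearMap.trace ℝ (Euc n) (fderiv ℝ V z).toLinearMap = -∫ z, fderiv ℝ ψ z (V z) := by
  have hVd : ∀ z ∈ Ω, DifferentiableAt ℝ V z := fun z hz =>
    (hV.contDiffAt (hΩ.mem_nhds hz)).differentiableAt (by simp)
  have hVi : ∀ (i : Fin n), ∀ z ∈ Ω, HasFDerivAt (fun z => V z i)
      ((EuclideanSpace.proj i : Euc n →L[ℝ] ℝ).comp (fderiv ℝ V z)) z := fun i z hz =>
    (EuclideanSpace.proj i : Euc n →L[ℝ] ℝ).hasFDerivAt.comp z (hVd z hz).hasFDerivAt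
  have hV' : ContinuousOn (fderiv ℝ V) Ω := hV.continuousOn_fderiv_of_isOpen hΩ le_rfl
  -- Nothing is known about `V` outside `Ω`, but a factor supported in `tsupport ψ ⊆ Ω` makes each
  -- product globally continuous with compact support.
  have hcont : ∀ {a b : Euc n → ℝ}, Continuous a → tsupport a ⊆ tsupport ψ → ContinuousOn b Ω →
      Integrable (fun z => a z * b z) := by
    intro a b ha has hb
    have hct : Continuous fun z => a z * b z := by
      refine continuous_iff_continuousAt.2 fun z => ?_
      by_cases hz : z ∈ Ω
      · exact ha.continuousAt.mul (hb.continuousAt (hΩ.mem_nhds hz))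
      · have hz' : z ∉ tsupport a := fun h => hz (hs (has h))
        refine (continuousAt_const (y := (0 : ℝ))).congr ?_
        filter_upwards [(isClosed_tsupport a).isOpen_compl.mem_nhds hz'] with y hy
        simp [image_eq_zero_of_notMem_tsupport hy]
    exact hct.integrable_of_hasCompactSupport ((hc.mono' (subset_closure.trans has)).mul_right)
  have hψ' : ∀ v : Euc n, Continuous fun z => fderiv ℝ ψ z v := fun v =>
    (hψ.continuous_fderiv (by simp)).clm_apply continuous_const
  have hψs : ∀ v : Euc n, tsupport (fun z => fderiv ℝ ψ z v) ⊆ tsupport ψ := fun v =>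
    tsupport_fderiv_apply_subset ℝ v
  have hVic : ∀ i, ContinuousOn (fun z => V z i) Ω := fun i =>
    (EuclideanSpace.proj i : Euc n →L[ℝ] ℝ).continuous.comp_continuousOn hV.continuousOn
  have hVic' : ∀ i, ContinuousOn (fun z => fderiv ℝ V z (EuclideanSpace.single i 1) i) Ω := fun i =>
    (EuclideanSpace.proj i : Euc n →L[ℝ] ℝ).continuous.comp_continuousOn
      (hV'.clm_apply continuousOn_const)
  have hi : ∀ i : Fin n, ∫ z, ψ z * fderiv ℝ V z (EuclideanSpace.single i 1) i =
      -∫ z, fderiv ℝ ψ z (EuclideanSpace.single i 1) * V z i := fun i =>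
    integral_bilinear_hasFDerivAt_right_eq_neg_left_of_integrable (μ := volume)
      (B := ContinuousLinearMap.mul ℝ ℝ) (v := EuclideanSpace.single i (1 : ℝ))
      (f := ψ) (f' := fderiv ℝ ψ) (g := fun z => V z i)
      (g' := fun z => (EuclideanSpace.proj i : Euc n →L[ℝ] ℝ).comp (fderiv ℝ V z))
      (hcont (hψ' _) (hψs _) (hVic i)) (hcont hψ.continuous subset_rfl (hVic' i))
      (hcont hψ.continuous subset_rfl (hVic i))
      (fun z _ => (hψ.differentiable (by simp) z).hasFDerivAt) (fun z hz => hVi i z (hs hz))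
  have htr : ∀ z, LinearMap.trace ℝ (Euc n) (fderiv ℝ V z).toLinearMap =
      ∑ i, fderiv ℝ V z (EuclideanSpace.single i 1) i := by
    intro z
    rw [LinearMap.trace_eq_matrix_trace ℝ (stdBasis n)]
    simp [Matrix.trace, LinearMap.toMatrix_apply]
  have hsum : ∀ z, fderiv ℝ ψ z (V z) = ∑ i, fderiv ℝ ψ z (EuclideanSpace.single i 1) * V z i := by
    intro z
    conv_lhs => rw [← (EuclideanSpace.basisFun (Fin n) ℝ).sum_repr (V z)]
    simp [map_sum, mul_comm]
  simp only [htr, hsum, Finset.mul_sum]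
  rw [integral_finsetSum _ fun i _ => hcont hψ.continuous subset_rfl (hVic' i),
    integral_finsetSum _ fun i _ => hcont (hψ' _) (hψs _) (hVic i), ← Finset.sum_neg_distrib]
  exact Finset.sum_congr rfl fun i _ => hi i

/-! ### Gradients and smooth vector fields in coordinates. -/

section Gradient

variable {n : ℕ} {M : Type*} [TopologicalSpace M] [ChartedSpace (Euc n) M]
  [IsManifold 𝓘(ℝ, Euc n) ∞ M]

theorem contDiffOn_comp_chart_symm {F : Type*} [NormedAddCommGroup F] [NormedSpace ℝ F]
    {f : M → F} (hf : ContMDiff 𝓘(ℝ, Euc n) 𝓘(ℝ, F) ∞ f) (p : M) :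
    ContDiffOn ℝ ∞ (f ∘ (chartAt (Euc n) p).symm) (chartAt (Euc n) p).target :=
  (hf.comp_contMDiffOn (contMDiffOn_chart_symm (I := 𝓘(ℝ, Euc n)) (x := p) (n := ∞))).contDiffOn

/-- The derivative of a real function `f` at `x` in the direction of a tangent vector. -/
def dirDeriv (f : M → ℝ) (x : M) (v : TangentSpace 𝓘(ℝ, Euc n) x) : ℝ :=
  mfderiv 𝓘(ℝ, Euc n) 𝓘(ℝ, ℝ) f x v

theorem inner_grad_eq_dirDeriv (g : Metric n M) (f : M → ℝ) (x : M)
    (v : TangentSpace 𝓘(ℝ, Euc n) x) : g.inner x (grad g f x) v = dirDeriv f x v :=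
  inner_grad g f x v

theorem dirDeriv_chartFrame {f : M → ℝ} (hf : ContMDiff 𝓘(ℝ, Euc n) 𝓘(ℝ, ℝ) ∞ f) {p : M} {z : Euc n}
    (hz : z ∈ (chartAt (Euc n) p).target) (v : Euc n) :
    dirDeriv f ((chartAt (Euc n) p).symm z) (chartFrame p z v) =
      fderiv ℝ (f ∘ (chartAt (Euc n) p).symm) z v := by
  have h := mfderiv_comp z (hf.mdifferentiable (by simp) ((chartAt (Euc n) p).symm z))
    ((mdifferentiable_chart_smooth p).mdifferentiableAt_symm hz)
  have h2 := mfderiv_eq_fderiv (𝕜 := ℝ) (f := f ∘ (chartAt (Euc n) p).symm) (x := z)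
  exact congrArg (fun L : Euc n →L[ℝ] ℝ => L v) (h.symm.trans h2)

theorem dirDeriv_eq_coordRep {f : M → ℝ} (hf : ContMDiff 𝓘(ℝ, Euc n) 𝓘(ℝ, ℝ) ∞ f) {p : M}
    {z : Euc n} (hz : z ∈ (chartAt (Euc n) p).target)
    (X : (y : M) → TangentSpace 𝓘(ℝ, Euc n) y) :
    dirDeriv f ((chartAt (Euc n) p).symm z) (X ((chartAt (Euc n) p).symm z)) =
      fderiv ℝ (f ∘ (chartAt (Euc n) p).symm) z (coordRep p X z) := by
  rw [← dirDeriv_chartFrame hf hz]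
  exact congrArg _ (chartFrame_chartCoframe hz _).symm

theorem localForm_coordRep_grad (g : Metric n M) {f : M → ℝ}
    (hf : ContMDiff 𝓘(ℝ, Euc n) 𝓘(ℝ, ℝ) ∞ f) {p : M} {z : Euc n}
    (hz : z ∈ (chartAt (Euc n) p).target) (w : Euc n) :
    localForm g p z (coordRep p (grad g f) z) w = fderiv ℝ (f ∘ (chartAt (Euc n) p).symm) z w := by
  rw [← dirDeriv_chartFrame hf hz, ← inner_grad_eq_dirDeriv g f]
  exact congrArg (fun v => g.inner ((chartAt (Euc n) p).symm z) v (chartFrame p z w))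
    (chartFrame_chartCoframe hz (grad g f ((chartAt (Euc n) p).symm z)))

/-- Pairing the gradient with the basis vectors gives a row vector times the Gram matrix, which is
then inverted. This explicit form is what makes the gradient a smooth field. -/
theorem coordRep_grad_apply (g : Metric n M) {f : M → ℝ}
    (hf : ContMDiff 𝓘(ℝ, Euc n) 𝓘(ℝ, ℝ) ∞ f) {p : M} {z : Euc n}
    (hz : z ∈ (chartAt (Euc n) p).target) (i : Fin n) :
    coordRep p (grad g f) z i =
      ∑ j, fderiv ℝ (f ∘ (chartAt (Euc n) p).symm) z (EuclideanSpace.single j 1) *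
        (gram g p z)⁻¹ j i := by
  set X := coordRep p (grad g f) z with hX
  have h1 : Matrix.vecMul (fun i => X i) (gram g p z) =
      fun j => fderiv ℝ (f ∘ (chartAt (Euc n) p).symm) z (EuclideanSpace.single j 1) := by
    ext j
    rw [← localForm_coordRep_grad g hf hz]
    conv_rhs => rw [← hX, ← (EuclideanSpace.basisFun (Fin n) ℝ).sum_repr X]
    simp [Matrix.vecMul, dotProduct, gram_eq_toMatrix, LinearMap.BilinForm.toMatrix_apply]
  have h2 : (fun i => X i) = Matrix.vecMul
      (fun j => fderiv ℝ (f ∘ (chartAt (Euc n) p).symm) z (EuclideanSpace.single j 1))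
      (gram g p z)⁻¹ := by
    rw [← h1, Matrix.vecMul_vecMul, Matrix.mul_nonsing_inv _ (gram_det_pos g hz).ne'.isUnit,
      Matrix.vecMul_one]
  exact congrFun h2 i

/-- A vector field is smooth if all its coordinate representations are. -/
def SmoothField (X : (y : M) → TangentSpace 𝓘(ℝ, Euc n) y) : Prop :=
  ∀ p : M, ContDiffOn ℝ ∞ (coordRep p X) (chartAt (Euc n) p).target

theorem smoothField_grad (g : Metric n M) {f : M → ℝ} (hf : ContMDiff 𝓘(ℝ, Euc n) 𝓘(ℝ, ℝ) ∞ f) :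
    SmoothField (grad g f) := by
  intro p
  have ho := (chartAt (Euc n) p).open_target
  refine contDiffOn_euclidean.2 fun i => ContDiffOn.congr ?_ fun z hz => coordRep_grad_apply g hf hz i
  refine ContDiffOn.sum fun j _ => ContDiffOn.mul ?_ ?_
  · exact ((contDiffOn_comp_chart_symm hf p).fderiv_of_isOpen ho (by simp)).clm_apply contDiffOn_const
  · exact ContDiffOn.matrix_inv (contDiffOn_gram g p) (fun z hz => (gram_det_pos g hz).ne') j i

omit [IsManifold 𝓘(ℝ, Euc n) ∞ M] in
theorem continuous_of_continuousOn_target {F : Type*} [TopologicalSpace F] {f : M → F}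
    (h : ∀ p : M, ContinuousOn (f ∘ (chartAt (Euc n) p).symm) (chartAt (Euc n) p).target) :
    Continuous f := by
  refine continuous_iff_continuousAt.2 fun p => ?_
  have hp := mem_chart_source (Euc n) p
  rw [(chartAt (Euc n) p).symm.continuousAt_iff_continuousAt_comp_right (by simp)]
  exact (h p).continuousAt ((chartAt (Euc n) p).open_target.mem_nhds
    ((chartAt (Euc n) p).map_source hp))

theorem continuous_dirDeriv {f : M → ℝ} (hf : ContMDiff 𝓘(ℝ, Euc n) 𝓘(ℝ, ℝ) ∞ f)
    {X : (y : M) → TangentSpace 𝓘(ℝ, Euc n) y} (hX : SmoothField X) :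
    Continuous fun x => dirDeriv f x (X x) := by
  refine continuous_of_continuousOn_target (n := n) fun p => ?_
  refine ContinuousOn.congr ?_ fun z hz => dirDeriv_eq_coordRep hf hz X
  exact ((contDiffOn_comp_chart_symm hf p).continuousOn_fderiv_of_isOpen
    (chartAt (Euc n) p).open_target (by simp)).clm_apply (hX p).continuousOn

end Gradient

/-! ### Chart independence of the divergence and the divergence theorem. -/

section Divergence

variable {n : ℕ} {M : Type*} [TopologicalSpace M] [ChartedSpace (Euc n) M]
  [IsManifold 𝓘(ℝ, Euc n) ∞ M]

/-- The divergence of a vector field, computed in the chart at `p` at the point `z`. -/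
def localDiv (g : Metric n M) (p : M) (X : (y : M) → TangentSpace 𝓘(ℝ, Euc n) y) (z : Euc n) : ℝ :=
  (density g p z)⁻¹ *
    LinearMap.trace ℝ (Euc n) (fderiv ℝ (fun z => density g p z • coordRep p X z) z).toLinearMap

theorem contDiffOn_density_smul (g : Metric n M) {X : (y : M) → TangentSpace 𝓘(ℝ, Euc n) y}
    (hX : SmoothField X) (p : M) :
    ContDiffOn ℝ ∞ (fun z => density g p z • coordRep p X z) (chartAt (Euc n) p).target :=
  (contDiffOn_density g p).smul (hX p)

theorem continuousOn_localDiv (g : Metric n M) {X : (y : M) → TangentSpace 𝓘(ℝ, Euc n) y}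
    (hX : SmoothField X) (p : M) : ContinuousOn (localDiv g p X) (chartAt (Euc n) p).target := by
  refine ((contDiffOn_density g p).continuousOn.inv₀ fun z hz => (density_pos g hz).ne').mul ?_
  have h := (contDiffOn_density_smul g hX p).continuousOn_fderiv_of_isOpen
    (chartAt (Euc n) p).open_target (by simp)
  simp only [LinearMap.trace_eq_matrix_trace ℝ (stdBasis n), Matrix.trace, Matrix.diag,
    LinearMap.toMatrix_apply]
  refine continuousOn_finsetSum _ fun i _ => ?_
  exact (EuclideanSpace.proj i : Euc n →L[ℝ] ℝ).continuous.comp_continuousOn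
    (h.clm_apply continuousOn_const)

variable [T2Space M]

/-- A test function supported in the chart domain at `p`, read in that chart. -/
def localTest (p : M) (ψ : M → ℝ) : Euc n → ℝ :=
  (chartAt (Euc n) p).target.indicator (ψ ∘ (chartAt (Euc n) p).symm)

omit [IsManifold 𝓘(ℝ, Euc n) ∞ M] [T2Space M] in
theorem localTest_eq_zero {p : M} {ψ : M → ℝ} {z : Euc n}
    (hz : z ∉ chartAt (Euc n) p '' tsupport ψ) : localTest p ψ z = 0 := by
  by_contra h
  have hz' := mem_of_indicator_ne_zero h
  rw [localTest, indicator_of_mem hz'] at h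
  exact hz ⟨_, subset_tsupport _ h, (chartAt (Euc n) p).right_inv hz'⟩

omit [IsManifold 𝓘(ℝ, Euc n) ∞ M] [T2Space M] in
theorem isCompact_chart_image {p : M} {K : Set M} (hK : IsCompact K)
    (hs : K ⊆ (chartAt (Euc n) p).source) : IsCompact (chartAt (Euc n) p '' K) :=
  hK.image_of_continuousOn ((chartAt (Euc n) p).continuousOn.mono hs)

omit [IsManifold 𝓘(ℝ, Euc n) ∞ M] [T2Space M] in
theorem tsupport_localTest {p : M} {ψ : M → ℝ} (hc : HasCompactSupport ψ)
    (hs : tsupport ψ ⊆ (chartAt (Euc n) p).source) :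
    tsupport (localTest (n := n) p ψ) ⊆ chartAt (Euc n) p '' tsupport ψ :=
  closure_minimal (fun _ hz => by_contra fun h => hz (localTest_eq_zero h))
    (isCompact_chart_image hc hs).isClosed

omit [IsManifold 𝓘(ℝ, Euc n) ∞ M] [T2Space M] in
theorem tsupport_localTest_subset_target {p : M} {ψ : M → ℝ} (hc : HasCompactSupport ψ)
    (hs : tsupport ψ ⊆ (chartAt (Euc n) p).source) :
    tsupport (localTest (n := n) p ψ) ⊆ (chartAt (Euc n) p).target :=
  (tsupport_localTest hc hs).trans (image_subset_iff.2 fun _ hx => (chartAt (Euc n) p).map_source (hs hx))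

omit [IsManifold 𝓘(ℝ, Euc n) ∞ M] [T2Space M] in
theorem hasCompactSupport_localTest {p : M} {ψ : M → ℝ} (hc : HasCompactSupport ψ)
    (hs : tsupport ψ ⊆ (chartAt (Euc n) p).source) : HasCompactSupport (localTest (n := n) p ψ) :=
  .of_support_subset_isCompact (isCompact_chart_image hc hs)
    ((subset_tsupport _).trans (tsupport_localTest hc hs))

omit [IsManifold 𝓘(ℝ, Euc n) ∞ M] [T2Space M] in
theorem localTest_eventuallyEq {p : M} (ψ : M → ℝ) {z : Euc n} (hz : z ∈ (chartAt (Euc n) p).target) :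
    localTest p ψ =ᶠ[nhds z] ψ ∘ (chartAt (Euc n) p).symm := by
  filter_upwards [(chartAt (Euc n) p).open_target.mem_nhds hz] with y hy
  exact indicator_of_mem hy _

omit [T2Space M] in
theorem contDiff_localTest {p : M} {ψ : M → ℝ} (hψ : ContMDiff 𝓘(ℝ, Euc n) 𝓘(ℝ, ℝ) ∞ ψ)
    (hc : HasCompactSupport ψ) (hs : tsupport ψ ⊆ (chartAt (Euc n) p).source) :
    ContDiff ℝ ∞ (localTest (n := n) p ψ) := by
  refine contDiff_iff_contDiffAt.2 fun z => ?_
  by_cases hz : z ∈ (chartAt (Euc n) p).target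
  · exact ((contDiffOn_comp_chart_symm hψ p).contDiffAt
      ((chartAt (Euc n) p).open_target.mem_nhds hz)).congr_of_eventuallyEq (localTest_eventuallyEq ψ hz)
  · have h : z ∉ tsupport (localTest (n := n) p ψ) :=
      fun h => hz (tsupport_localTest_subset_target hc hs h)
    exact contDiffAt_const.congr_of_eventuallyEq (notMem_tsupport_iff_eventuallyEq.1 h)

variable [SecondCountableTopology M] [MeasurableSpace M] [BorelSpace M]

omit [T2Space M] [IsManifold 𝓘(ℝ, Euc n) ∞ M] [SecondCountableTopology M] [MeasurableSpace M]
  [BorelSpace M] in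
theorem continuous_mul_of_tsupport_subset {a b : M → ℝ} {Ω : Set M} (hΩ : IsOpen Ω) (ha : Continuous a)
    (hs : tsupport a ⊆ Ω) (hb : ContinuousOn b Ω) : Continuous fun x => a x * b x := by
  refine continuous_iff_continuousAt.2 fun z => ?_
  by_cases hz : z ∈ Ω
  · exact ha.continuousAt.mul (hb.continuousAt (hΩ.mem_nhds hz))
  · refine (continuousAt_const (y := (0 : ℝ))).congr ?_
    filter_upwards [(isClosed_tsupport a).isOpen_compl.mem_nhds fun h => hz (hs h)] with y hy
    simp [image_eq_zero_of_notMem_tsupport hy]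

omit [IsManifold 𝓘(ℝ, Euc n) ∞ M] [SecondCountableTopology M] [MeasurableSpace M] [BorelSpace M]
  [T2Space M] in
theorem dirDeriv_of_notMem_tsupport {f : M → ℝ} {x : M} (hx : x ∉ tsupport f)
    (v : TangentSpace 𝓘(ℝ, Euc n) x) : dirDeriv f x v = 0 := by
  have h := (notMem_tsupport_iff_eventuallyEq.1 hx).mfderiv_eq (I := 𝓘(ℝ, Euc n)) (I' := 𝓘(ℝ, ℝ))
  have h2 : mfderiv 𝓘(ℝ, Euc n) 𝓘(ℝ, ℝ) (fun _ : M => (0 : ℝ)) x = 0 := mfderiv_const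
  exact congrArg (fun L : Euc n →L[ℝ] ℝ => L v) (h.trans h2)

omit [T2Space M] in
-- The volume density cancels the `1/√det g` in the divergence, leaving Euclidean integration by
-- parts for the field `√det g · X`. The right-hand side no longer mentions the chart.
theorem integral_mul_localDiv (g : Metric n M) {X : (y : M) → TangentSpace 𝓘(ℝ, Euc n) y}
    (hX : SmoothField X) {p : M} {ψ : M → ℝ} (hψ : ContMDiff 𝓘(ℝ, Euc n) 𝓘(ℝ, ℝ) ∞ ψ)
    (hc : HasCompactSupport ψ) (hs : tsupport ψ ⊆ (chartAt (Euc n) p).source) :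
    ∫ x, ψ x * localDiv g p X (chartAt (Euc n) p x) ∂(riemVolume g) =
      -∫ x, dirDeriv ψ x (X x) ∂(riemVolume g) := by
  set e := chartAt (Euc n) p with he
  have ho := e.open_target
  have hcont : Continuous fun x => ψ x * localDiv g p X (e x) :=
    continuous_mul_of_tsupport_subset e.open_source hψ.continuous hs
      ((continuousOn_localDiv g hX p).comp e.continuousOn fun x hx => e.map_source hx)
  rw [integral_riemVolume_of_support g p hcont.aestronglyMeasurable
      (fun x hx => hs (subset_tsupport _ (left_ne_zero_of_mul hx))),
    integral_riemVolume_of_support g p (continuous_dirDeriv hψ hX).aestronglyMeasurable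
      (fun x hx => by_contra fun h => hx
        (dirDeriv_of_notMem_tsupport (fun h' => h (hs h')) _))]
  have h1 : ∀ z ∈ e.target, density g p z * (ψ (e.symm z) * localDiv g p X (e (e.symm z))) =
      localTest p ψ z * LinearMap.trace ℝ (Euc n)
        (fderiv ℝ (fun z => density g p z • coordRep p X z) z).toLinearMap := by
    intro z hz
    have hd := (density_pos g hz).ne'
    rw [e.right_inv hz, localDiv, localTest, indicator_of_mem hz]
    simp only [Function.comp_apply, ← he]
    field_simp
  have h2 : ∀ z ∈ e.target, density g p z * dirDeriv ψ (e.symm z) (X (e.symm z)) =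
      fderiv ℝ (localTest p ψ) z (density g p z • coordRep p X z) := by
    intro z hz
    rw [map_smul, smul_eq_mul, (localTest_eventuallyEq ψ hz).fderiv_eq, ← dirDeriv_eq_coordRep hψ hz]
  rw [setIntegral_congr_fun ho.measurableSet h1, setIntegral_congr_fun ho.measurableSet h2,
    setIntegral_eq_integral_of_forall_compl_eq_zero,
    setIntegral_eq_integral_of_forall_compl_eq_zero]
  · exact integral_mul_trace_fderiv ho ((contDiff_localTest hψ hc hs).of_le (by simp))
      (hasCompactSupport_localTest hc hs) (tsupport_localTest_subset_target hc hs)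
      ((contDiffOn_density_smul g hX p).of_le (by simp))
  · intro z hz
    have h : z ∉ tsupport (localTest (n := n) p ψ) :=
      fun h => hz (tsupport_localTest_subset_target hc hs h)
    rw [fderiv_of_notMem_tsupport ℝ h]
    rfl
  · intro z hz
    rw [localTest, indicator_of_notMem hz, zero_mul]

/-- The divergence is independent of the chart. -/
theorem localDiv_eq_localDiv (g : Metric n M) {X : (y : M) → TangentSpace 𝓘(ℝ, Euc n) y}
    (hX : SmoothField X) {p q x : M} (hp : x ∈ (chartAt (Euc n) p).source)
    (hq : x ∈ (chartAt (Euc n) q).source) :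
    localDiv g p X (chartAt (Euc n) p x) = localDiv g q X (chartAt (Euc n) q x) := by
  have : LocallyCompactSpace M := ChartedSpace.locallyCompactSpace (Euc n) M
  have := isLocallyFiniteMeasure_riemVolume g
  have := isOpenPosMeasure_riemVolume g
  set U := (chartAt (Euc n) p).source ∩ (chartAt (Euc n) q).source
  have hU : IsOpen U := (chartAt (Euc n) p).open_source.inter (chartAt (Euc n) q).open_source
  have hcont : ∀ p : M, ContinuousOn (fun x => localDiv g p X (chartAt (Euc n) p x))
      (chartAt (Euc n) p).source := fun p =>
    (continuousOn_localDiv g hX p).comp (chartAt (Euc n) p).continuousOn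
      fun x hx => (chartAt (Euc n) p).map_source hx
  have hd := ((hcont p).mono (inter_subset_left : U ⊆ _)).sub ((hcont q).mono inter_subset_right)
  -- A weak argument replaces the transformation law: by `integral_mul_localDiv` both expressions
  -- have the same integral against every test function supported in the overlap. Their difference
  -- is continuous and vanishes almost everywhere, hence everywhere.
  have hae := hU.ae_eq_zero_of_integral_contMDiff_smul_eq_zero 𝓘(ℝ, Euc n) (μ := riemVolume g)
    (hd.locallyIntegrableOn hU.measurableSet) fun ψ hψ hc hs => by
      have hi : ∀ p : M, tsupport ψ ⊆ (chartAt (Euc n) p).source →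
          Integrable (fun x => ψ x * localDiv g p X (chartAt (Euc n) p x)) (riemVolume g) :=
        fun p hs => (continuous_mul_of_tsupport_subset (chartAt (Euc n) p).open_source hψ.continuous
          hs (hcont p)).integrable_of_hasCompactSupport hc.mul_right
      have hsp := hs.trans (inter_subset_left : U ⊆ _)
      have hsq := hs.trans (inter_subset_right : U ⊆ _)
      simp only [smul_eq_mul, Pi.sub_apply, mul_sub]
      rw [integral_sub (hi p hsp) (hi q hsq), integral_mul_localDiv g hX hψ hc hsp,
        integral_mul_localDiv g hX hψ hc hsq, sub_self]
  have h0 := Measure.eqOn_open_of_ae_eq (μ := riemVolume g) (U := U) (g := fun _ => (0 : ℝ))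
    ((ae_restrict_iff' hU.measurableSet).2 hae) hU hd continuousOn_const
  exact sub_eq_zero.1 (h0 ⟨hp, hq⟩)

theorem divergence_eq_localDiv (g : Metric n M) {X : (y : M) → TangentSpace 𝓘(ℝ, Euc n) y}
    (hX : SmoothField X) {p x : M} (hp : x ∈ (chartAt (Euc n) p).source) :
    divergence g X x = localDiv g p X (chartAt (Euc n) p x) :=
  localDiv_eq_localDiv g hX (mem_chart_source (Euc n) x) hp

theorem continuous_divergence (g : Metric n M) {X : (y : M) → TangentSpace 𝓘(ℝ, Euc n) y}
    (hX : SmoothField X) : Continuous (divergence g X) := by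
  refine continuous_of_continuousOn_target (n := n) fun p => ?_
  refine (continuousOn_localDiv g hX p).congr fun z hz => ?_
  rw [Function.comp_apply, divergence_eq_localDiv g hX ((chartAt (Euc n) p).map_target hz),
    (chartAt (Euc n) p).right_inv hz]

omit [SecondCountableTopology M] [MeasurableSpace M] [BorelSpace M] [T2Space M]
  [IsManifold 𝓘(ℝ, Euc n) ∞ M] in
theorem dirDeriv_add {ψ η : M → ℝ} (hψ : ContMDiff 𝓘(ℝ, Euc n) 𝓘(ℝ, ℝ) ∞ ψ)
    (hη : ContMDiff 𝓘(ℝ, Euc n) 𝓘(ℝ, ℝ) ∞ η) (x : M) (v : TangentSpace 𝓘(ℝ, Euc n) x) :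
    dirDeriv (fun y => ψ y + η y) x v = dirDeriv ψ x v + dirDeriv η x v :=
  congrArg (fun L : Euc n →L[ℝ] ℝ => L v)
    (mfderiv_add (hψ.mdifferentiable (by simp) x) (hη.mdifferentiable (by simp) x))

omit [SecondCountableTopology M] [MeasurableSpace M] [BorelSpace M] [T2Space M]
  [IsManifold 𝓘(ℝ, Euc n) ∞ M] in
theorem dirDeriv_sum {ι : Type*} (s : Finset ι) {η : ι → M → ℝ}
    (hη : ∀ i, ContMDiff 𝓘(ℝ, Euc n) 𝓘(ℝ, ℝ) ∞ (η i)) (x : M) (v : TangentSpace 𝓘(ℝ, Euc n) x) :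
    dirDeriv (fun y => ∑ i ∈ s, η i y) x v = ∑ i ∈ s, dirDeriv (η i) x v := by
  classical
  induction s using Finset.induction_on with
  | empty =>
    have h : x ∉ tsupport (fun _ : M => (0 : ℝ)) := by simp [tsupport, Function.support]
    simpa using dirDeriv_of_notMem_tsupport h v
  | insert i s hi ih =>
    simp only [Finset.sum_insert hi]
    rw [dirDeriv_add (hη i) (contMDiff_finsetSum fun i _ => hη i), ih]

/-- **Divergence theorem** for a smooth vector field and a compactly supported function. -/
theorem integral_mul_divergence (g : Metric n M) {X : (y : M) → TangentSpace 𝓘(ℝ, Euc n) y}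
    (hX : SmoothField X) {ψ : M → ℝ} (hψ : ContMDiff 𝓘(ℝ, Euc n) 𝓘(ℝ, ℝ) ∞ ψ)
    (hc : HasCompactSupport ψ) :
    ∫ x, ψ x * divergence g X x ∂(riemVolume g) =
      -∫ x, dirDeriv ψ x (X x) ∂(riemVolume g) := by
  have := isLocallyFiniteMeasure_riemVolume g
  have : LocallyCompactSpace M := ChartedSpace.locallyCompactSpace (Euc n) M
  have hint : ∀ {η : M → ℝ}, ContMDiff 𝓘(ℝ, Euc n) 𝓘(ℝ, ℝ) ∞ η → HasCompactSupport η →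
      Integrable (fun x => η x * divergence g X x) (riemVolume g) := fun hη hc =>
    (hη.continuous.mul (continuous_divergence g hX)).integrable_of_hasCompactSupport hc.mul_right
  have hint' : ∀ {η : M → ℝ}, ContMDiff 𝓘(ℝ, Euc n) 𝓘(ℝ, ℝ) ∞ η → HasCompactSupport η →
      Integrable (fun x => dirDeriv η x (X x)) (riemVolume g) :=
    fun hη hc => (continuous_dirDeriv hη hX).integrable_of_hasCompactSupport
      (.of_support_subset_isCompact hc fun x hx => by_contra fun h => hx
        (dirDeriv_of_notMem_tsupport h _))
  -- Finitely many chart domains cover the support of `ψ`; a subordinate partition of unity splits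
  -- `ψ` into test functions each supported in one chart.
  obtain ⟨t, ht⟩ := hc.isCompact.elim_nhds_subcover' (U := fun x _ => (chartAt (Euc n) x).source)
    fun x _ => (chartAt (Euc n) x).open_source.mem_nhds (mem_chart_source (Euc n) x)
  obtain ⟨ρ, hρ⟩ := SmoothPartitionOfUnity.exists_isSubordinate 𝓘(ℝ, Euc n) (isClosed_tsupport ψ)
    (fun i : t => (chartAt (Euc n) (i : M)).source) (fun i => (chartAt (Euc n) (i : M)).open_source)
    (fun x hx => by
      obtain ⟨i, hi, hxi⟩ := mem_iUnion₂.1 (ht hx)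
      exact mem_iUnion.2 ⟨⟨i, hi⟩, hxi⟩)
  set η : t → M → ℝ := fun i x => ρ i x * ψ x with hη
  have hηs : ∀ i, ContMDiff 𝓘(ℝ, Euc n) 𝓘(ℝ, ℝ) ∞ (η i) := fun i => (ρ i).contMDiff.mul hψ
  have hηc : ∀ i, HasCompactSupport (η i) := fun i => hc.mul_left
  have hηt : ∀ i : t, tsupport (η i) ⊆ (chartAt (Euc n) (i : M)).source := fun i =>
    (closure_mono (Function.support_mul_subset_left (ρ i) ψ)).trans (hρ i)
  have hsum : ψ = fun x => ∑ i, η i x := by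
    ext x
    rw [hη, ← Finset.sum_mul]
    by_cases hx : x ∈ tsupport ψ
    · have h1 := ρ.sum_eq_one hx
      rw [finsum_eq_sum_of_fintype] at h1
      rw [h1, one_mul]
    · rw [image_eq_zero_of_notMem_tsupport hx, mul_zero]
  have hloc : ∀ i, ∫ x, η i x * divergence g X x ∂(riemVolume g) =
      -∫ x, dirDeriv (η i) x (X x) ∂(riemVolume g) := by
    intro i
    rw [← integral_mul_localDiv g hX (hηs i) (hηc i) (hηt i)]
    refine integral_congr_ae (.of_forall fun x => ?_)
    by_cases hx : x ∈ (chartAt (Euc n) (i : M)).source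
    · simp only [divergence_eq_localDiv g hX hx]
    · simp only [image_eq_zero_of_notMem_tsupport fun h => hx (hηt i h), zero_mul]
  rw [hsum]
  simp only [dirDeriv_sum Finset.univ hηs, Finset.sum_mul]
  rw [integral_finsetSum _ fun i _ => hint (hηs i) (hηc i),
    integral_finsetSum _ fun i _ => hint' (hηs i) (hηc i), ← Finset.sum_neg_distrib]
  exact Finset.sum_congr rfl fun i _ => hloc i

end Divergence

/-! ### Green's formula for the drift Laplacian. -/

section Drift

variable {n : ℕ} {M : Type*} [TopologicalSpace M] [ChartedSpace (Euc n) M]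
  [IsManifold 𝓘(ℝ, Euc n) ∞ M]

omit [IsManifold 𝓘(ℝ, Euc n) ∞ M] in
-- Inserting `e^{-φ} ψ` into the unweighted divergence theorem yields the weighted formula:
-- differentiating the weight produces the drift term.
theorem dirDeriv_exp_neg_mul {φ ψ : M → ℝ} (hφ : ContMDiff 𝓘(ℝ, Euc n) 𝓘(ℝ, ℝ) ∞ φ)
    (hψ : ContMDiff 𝓘(ℝ, Euc n) 𝓘(ℝ, ℝ) ∞ ψ) (x : M) (v : TangentSpace 𝓘(ℝ, Euc n) x) :
    dirDeriv (fun y => Real.exp (-φ y) * ψ y) x v =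
      Real.exp (-φ x) * (dirDeriv ψ x v - ψ x * dirDeriv φ x v) := by
  have h1 := (hφ.mdifferentiable (by simp) x).hasMFDerivAt
  have h2 := (hψ.mdifferentiable (by simp) x).hasMFDerivAt
  have he : HasFDerivAt (fun s : ℝ => Real.exp (-s))
      (ContinuousLinearMap.toSpanSingleton ℝ (-Real.exp (-φ x))) (φ x) := by
    have : HasDerivAt (fun s : ℝ => Real.exp (-s)) (-Real.exp (-φ x)) (φ x) := by
      simpa using ((hasDerivAt_id (φ x)).neg).exp
    exact this.hasFDerivAt
  have h3 := HasMFDerivAt.comp (I := 𝓘(ℝ, Euc n)) (I' := 𝓘(ℝ, ℝ)) (I'' := 𝓘(ℝ, ℝ)) x he.hasMFDerivAt h1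
  have h4 := (h3.mul h2).mfderiv
  refine (congrArg (fun L : Euc n →L[ℝ] ℝ => L v) h4).trans ?_
  change Real.exp (-φ x) * dirDeriv ψ x v + ψ x * (dirDeriv φ x v * -Real.exp (-φ x)) = _
  ring

omit [IsManifold 𝓘(ℝ, Euc n) ∞ M] in
theorem dirDeriv_sub {ψ η : M → ℝ} (hψ : ContMDiff 𝓘(ℝ, Euc n) 𝓘(ℝ, ℝ) ∞ ψ)
    (hη : ContMDiff 𝓘(ℝ, Euc n) 𝓘(ℝ, ℝ) ∞ η) (x : M) (v : TangentSpace 𝓘(ℝ, Euc n) x) :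
    dirDeriv (fun y => ψ y - η y) x v = dirDeriv ψ x v - dirDeriv η x v :=
  congrArg (fun L : Euc n →L[ℝ] ℝ => L v)
    (mfderiv_sub (hψ.mdifferentiable (by simp) x) (hη.mdifferentiable (by simp) x))

theorem grad_sub (g : Metric n M) {ψ η : M → ℝ} (hψ : ContMDiff 𝓘(ℝ, Euc n) 𝓘(ℝ, ℝ) ∞ ψ)
    (hη : ContMDiff 𝓘(ℝ, Euc n) 𝓘(ℝ, ℝ) ∞ η) (x : M) :
    grad g (fun y => ψ y - η y) x = grad g ψ x - grad g η x := by
  rw [grad, grad, grad, ← map_sub]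
  congr 1
  ext v
  exact dirDeriv_sub hψ hη x v

variable [T2Space M] [SecondCountableTopology M] [MeasurableSpace M] [BorelSpace M]

/-- **Green's formula** for the drift Laplacian, against a compactly supported function. -/
theorem integral_mul_drift (g : Metric n M) {φ f ψ : M → ℝ}
    (hφ : ContMDiff 𝓘(ℝ, Euc n) 𝓘(ℝ, ℝ) ∞ φ) (hf : ContMDiff 𝓘(ℝ, Euc n) 𝓘(ℝ, ℝ) ∞ f)
    (hψ : ContMDiff 𝓘(ℝ, Euc n) 𝓘(ℝ, ℝ) ∞ ψ) (hc : HasCompactSupport ψ) :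
    ∫ x, ψ x * (laplacian g f x - g.inner x (grad g f x) (grad g φ x)) ∂(weightedVolume g φ) =
      -∫ x, g.inner x (grad g ψ x) (grad g f x) ∂(weightedVolume g φ) := by
  have := isLocallyFiniteMeasure_riemVolume g
  have hX := smoothField_grad g hf
  have hη : ContMDiff 𝓘(ℝ, Euc n) 𝓘(ℝ, ℝ) ∞ fun y => Real.exp (-φ y) * ψ y :=
    (Real.contDiff_exp.contMDiff.comp hφ.neg).mul hψ
  have hηc : HasCompactSupport fun y => Real.exp (-φ y) * ψ y := hc.mul_left
  have key := integral_mul_divergence g hX hη hηc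
  rw [integral_weightedVolume g hφ.continuous, integral_weightedVolume g hφ.continuous]
  have hE : Integrable (fun x => Real.exp (-φ x) * ψ x * dirDeriv φ x (grad g f x)) (riemVolume g) :=
    (hη.continuous.mul (continuous_dirDeriv hφ hX)).integrable_of_hasCompactSupport hηc.mul_right
  have h1 : Integrable (fun x => Real.exp (-φ x) * ψ x * divergence g (grad g f) x) (riemVolume g) :=
    (hη.continuous.mul (continuous_divergence g hX)).integrable_of_hasCompactSupport hηc.mul_right
  have h2 : Integrable (fun x => Real.exp (-φ x) * dirDeriv ψ x (grad g f x)) (riemVolume g) := by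
    refine ((Real.continuous_exp.comp hφ.continuous.neg).mul
      (continuous_dirDeriv hψ hX)).integrable_of_hasCompactSupport
      (.of_support_subset_isCompact hc fun x hx => by_contra fun h => hx ?_)
    simp [dirDeriv_of_notMem_tsupport h]
  have e1 : ∀ x, Real.exp (-φ x) * (ψ x * (laplacian g f x - g.inner x (grad g f x) (grad g φ x))) =
      Real.exp (-φ x) * ψ x * divergence g (grad g f) x -
        Real.exp (-φ x) * ψ x * dirDeriv φ x (grad g f x) := fun x => by
    rw [g.symm, inner_grad_eq_dirDeriv, laplacian]
    ring
  have e2 : ∀ x, dirDeriv (fun y => Real.exp (-φ y) * ψ y) x (grad g f x) =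
      Real.exp (-φ x) * dirDeriv ψ x (grad g f x) -
        Real.exp (-φ x) * ψ x * dirDeriv φ x (grad g f x) := fun x => by
    rw [dirDeriv_exp_neg_mul hφ hψ]
    ring
  simp only [e2] at key
  rw [integral_sub h2 hE] at key
  simp only [e1]
  simp only [inner_grad_eq_dirDeriv]
  rw [integral_sub h1 hE, key]
  ring

end Drift

/-- The Cauchy–Schwarz inequality for the integral of a pointwise product. -/
theorem integrable_and_abs_integral_le {Ω : Type*} [MeasurableSpace Ω] {μ : Measure Ω}
    {F A B : Ω → ℝ} (hF : AEStronglyMeasurable F μ) (hA : Integrable A μ) (hB : Integrable B μ)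
    (hA0 : ∀ x, 0 ≤ A x) (hB0 : ∀ x, 0 ≤ B x) (h : ∀ x, F x ^ 2 ≤ A x * B x) :
    Integrable F μ ∧ |∫ x, F x ∂μ| ≤ √(∫ x, A x ∂μ) * √(∫ x, B x ∂μ) := by
  have hle : ∀ x, |F x| ≤ √(A x) * √(B x) := fun x => by
    rw [← Real.sqrt_mul (hA0 x)]
    exact Real.abs_le_sqrt (h x)
  have hsq : ∀ {C : Ω → ℝ}, Integrable C μ → (∀ x, 0 ≤ C x) → MemLp (fun x => √(C x)) 2 μ := by
    intro C hC hC0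
    rw [memLp_two_iff_integrable_sq (Real.continuous_sqrt.comp_aestronglyMeasurable
      hC.aestronglyMeasurable)]
    simpa only [Real.sq_sqrt (hC0 _)] using hC
  have hi : Integrable (fun x => √(A x) * √(B x)) μ := (hsq hA hA0).integrable_mul (hsq hB hB0)
  refine ⟨hi.mono' hF (.of_forall hle), ?_⟩
  have h2 : ENNReal.ofReal 2 = 2 := by simp
  have hcs := integral_mul_le_Lp_mul_Lq_of_nonneg (μ := μ) Real.HolderConjugate.two_two
    (f := fun x => √(A x)) (g := fun x => √(B x)) (.of_forall fun _ => Real.sqrt_nonneg _)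
    (.of_forall fun _ => Real.sqrt_nonneg _) (h2 ▸ hsq hA hA0) (h2 ▸ hsq hB hB0)
  simp only [Real.rpow_two, Real.sq_sqrt (hA0 _), Real.sq_sqrt (hB0 _), ← Real.sqrt_eq_rpow] at hcs
  calc |∫ x, F x ∂μ| ≤ ∫ x, |F x| ∂μ := abs_integral_le_integral_abs
    _ ≤ ∫ x, √(A x) * √(B x) ∂μ :=
      integral_mono_of_nonneg (.of_forall fun _ => abs_nonneg _) hi (.of_forall hle)
    _ ≤ _ := hcs

/-- A quantity bounded by arbitrarily small multiples of a constant vanishes. -/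
theorem eq_zero_of_forall_abs_le_sqrt {X K : ℝ} (h : ∀ ε > 0, |X| ≤ √ε * K) : X = 0 := by
  have ht : Filter.Tendsto (fun ε : ℝ => √ε * K) (nhdsWithin 0 (Ioi 0)) (nhds 0) := by
    have : Continuous fun ε : ℝ => √ε * K := by fun_prop
    simpa using (this.tendsto 0).mono_left nhdsWithin_le_nhds
  have := ge_of_tendsto ht (Filter.eventually_of_mem self_mem_nhdsWithin h)
  exact abs_nonpos_iff.1 this

/-! ### The weighted Sobolev space. -/

section Sobolev

variable {n N : ℕ} {M : Type*} [TopologicalSpace M] [ChartedSpace (Euc n) M]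
  [IsManifold 𝓘(ℝ, Euc n) ∞ M]

/-- The pairing `⟨∇f, ∇h⟩` of two `ℝᴺ`-valued functions. -/
def gradInner (g : Metric n M) (f h : M → Euc N) (x : M) : ℝ :=
  ∑ k, g.inner x (grad g (fun y => f y k) x) (grad g (fun y => h y k) x)

omit [IsManifold 𝓘(ℝ, Euc n) ∞ M] in
theorem contMDiff_coord {f : M → Euc N} (hf : ContMDiff 𝓘(ℝ, Euc n) 𝓘(ℝ, Euc N) ∞ f) (k : Fin N) :
    ContMDiff 𝓘(ℝ, Euc n) 𝓘(ℝ, ℝ) ∞ fun y => f y k :=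
  (EuclideanSpace.proj k : Euc N →L[ℝ] ℝ).contDiff.contMDiff.comp hf

theorem gradInner_self (g : Metric n M) (f : M → Euc N) (x : M) : gradInner g f f x = gradSq g f x :=
  rfl

theorem gradInner_comm (g : Metric n M) (f h : M → Euc N) (x : M) :
    gradInner g f h x = gradInner g h f x :=
  Finset.sum_congr rfl fun _ _ => g.symm _ _ _

theorem gradInner_sub_left (g : Metric n M) {f ψ : M → Euc N}
    (hf : ContMDiff 𝓘(ℝ, Euc n) 𝓘(ℝ, Euc N) ∞ f) (hψ : ContMDiff 𝓘(ℝ, Euc n) 𝓘(ℝ, Euc N) ∞ ψ)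
    (h : M → Euc N) (x : M) :
    gradInner g (fun y => f y - ψ y) h x = gradInner g f h x - gradInner g ψ h x := by
  simp only [gradInner, PiLp.sub_apply, ← Finset.sum_sub_distrib]
  refine Finset.sum_congr rfl fun k _ => ?_
  rw [grad_sub g (contMDiff_coord hf k) (contMDiff_coord hψ k), map_sub]
  rfl

theorem gradSq_nonneg (g : Metric n M) (f : M → Euc N) (x : M) : 0 ≤ gradSq g f x := by
  refine Finset.sum_nonneg fun k _ => ?_
  by_cases h : grad g (fun y => f y k) x = 0
  · rw [h]
    simp
  · exact (g.pos x _ h).le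

/-- The quadratic polynomial `t ↦ |∇f + t ∇h|²` is nonnegative, so its discriminant is at most zero.
-/
theorem gradInner_sq_le (g : Metric n M) (f h : M → Euc N) (x : M) :
    gradInner g f h x ^ 2 ≤ gradSq g f x * gradSq g h x := by
  have hnn : ∀ v : TangentSpace 𝓘(ℝ, Euc n) x, 0 ≤ g.inner x v v := fun v => by
    by_cases hv : v = 0
    · rw [hv]
      simp
    · exact (g.pos x v hv).le
  have key : ∀ t : ℝ, 0 ≤ gradSq g h x * (t * t) + 2 * gradInner g f h x * t + gradSq g f x := by
    intro t
    have : gradSq g h x * (t * t) + 2 * gradInner g f h x * t + gradSq g f x =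
        ∑ k, g.inner x (grad g (fun y => f y k) x + t • grad g (fun y => h y k) x)
          (grad g (fun y => f y k) x + t • grad g (fun y => h y k) x) := by
      simp only [gradSq, gradInner, Finset.sum_mul, Finset.mul_sum, ← Finset.sum_add_distrib]
      refine Finset.sum_congr rfl fun k _ => ?_
      simp only [map_add, map_smul, add_apply, smul_apply,
        smul_eq_mul]
      rw [g.symm x (grad g (fun y => h y k) x) (grad g (fun y => f y k) x)]
      ring
    rw [this]
    exact Finset.sum_nonneg fun k _ => hnn _
  have := discrim_le_zero key
  rw [discrim] at this
  nlinarith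

variable [T2Space M] [SecondCountableTopology M] [MeasurableSpace M] [BorelSpace M]

omit [T2Space M] [SecondCountableTopology M] [MeasurableSpace M] [BorelSpace M] in
theorem continuous_gradInner (g : Metric n M) {f h : M → Euc N}
    (hf : ContMDiff 𝓘(ℝ, Euc n) 𝓘(ℝ, Euc N) ∞ f) (hh : ContMDiff 𝓘(ℝ, Euc n) 𝓘(ℝ, Euc N) ∞ h) :
    Continuous (gradInner g f h) :=
  continuous_finsetSum _ fun k _ => by
    simp only [inner_grad_eq_dirDeriv]
    exact continuous_dirDeriv (contMDiff_coord hf k) (smoothField_grad g (contMDiff_coord hh k))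

omit [T2Space M] [SecondCountableTopology M] [MeasurableSpace M] [BorelSpace M] in
theorem support_gradInner_subset (g : Metric n M) (f h : M → Euc N) :
    Function.support (gradInner g f h) ⊆ tsupport f := by
  intro x hx
  by_contra hxf
  refine hx (Finset.sum_eq_zero fun k _ => ?_)
  rw [inner_grad_eq_dirDeriv]
  refine dirDeriv_of_notMem_tsupport (fun h' => hxf (closure_mono (fun y hy => ?_) h')) _
  intro h0
  exact hy (by simp [h0])

/-- Green's formula for `ℝᴺ`-valued functions, one of which is compactly supported. -/
theorem integral_inner_driftLaplacian (g : Metric n M) {φ : M → ℝ} {f ψ : M → Euc N}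
    (hφ : ContMDiff 𝓘(ℝ, Euc n) 𝓘(ℝ, ℝ) ∞ φ) (hf : ContMDiff 𝓘(ℝ, Euc n) 𝓘(ℝ, Euc N) ∞ f)
    (hψ : ContMDiff 𝓘(ℝ, Euc n) 𝓘(ℝ, Euc N) ∞ ψ) (hc : HasCompactSupport ψ) :
    ∫ x, inner ℝ (ψ x) (driftLaplacian g φ f x) ∂(weightedVolume g φ) =
      -∫ x, gradInner g ψ f x ∂(weightedVolume g φ) := by
  have := isLocallyFiniteMeasure_weightedVolume g hφ.continuous
  have hck : ∀ k, HasCompactSupport fun y => ψ y k := fun k =>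
    hc.comp_left (g := fun v : Euc N => v k) rfl
  simp only [PiLp.inner_apply, driftLaplacian, gradInner]
  rw [integral_finsetSum, integral_finsetSum, ← Finset.sum_neg_distrib]
  · refine Finset.sum_congr rfl fun k _ => ?_
    rw [← integral_mul_drift g hφ (contMDiff_coord hf k) (contMDiff_coord hψ k) (hck k)]
    simp [mul_comm]
  · intro k _
    simp only [inner_grad_eq_dirDeriv]
    refine (continuous_dirDeriv (contMDiff_coord hψ k) (smoothField_grad g
      (contMDiff_coord hf k))).integrable_of_hasCompactSupport
      (.of_support_subset_isCompact (hck k) fun x hx => by_contra fun h => hx ?_)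
    exact dirDeriv_of_notMem_tsupport h _
  · intro k _
    have hcont : Continuous fun x => ψ x k * (laplacian g (fun y => f y k) x -
        g.inner x (grad g (fun y => f y k) x) (grad g φ x)) := by
      simp only [inner_grad_eq_dirDeriv]
      exact (contMDiff_coord hψ k).continuous.mul
        ((continuous_divergence g (smoothField_grad g (contMDiff_coord hf k))).sub
          (continuous_dirDeriv (contMDiff_coord hf k) (smoothField_grad g hφ)))
    have := hcont.integrable_of_hasCompactSupport (μ := weightedVolume g φ) (hck k).mul_right
    simpa [mul_comm] using this

/-- Smooth functions with finite Sobolev norm. -/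
structure FiniteEnergy (g : Metric n M) (φ : M → ℝ) (f : M → Euc N) : Prop where
  smooth : ContMDiff 𝓘(ℝ, Euc n) 𝓘(ℝ, Euc N) ∞ f
  sq : Integrable (fun x => ‖f x‖ ^ 2) (weightedVolume g φ)
  grad : Integrable (gradSq g f) (weightedVolume g φ)

omit [T2Space M] [SecondCountableTopology M] [MeasurableSpace M] [BorelSpace M] in
theorem gradSq_sub (g : Metric n M) {f ψ : M → Euc N}
    (hf : ContMDiff 𝓘(ℝ, Euc n) 𝓘(ℝ, Euc N) ∞ f) (hψ : ContMDiff 𝓘(ℝ, Euc n) 𝓘(ℝ, Euc N) ∞ ψ) (x : M) :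
    gradSq g (fun y => f y - ψ y) x = gradSq g f x - 2 * gradInner g f ψ x + gradSq g ψ x := by
  rw [← gradInner_self, gradInner_sub_left g hf hψ, gradInner_comm g f, gradInner_comm g ψ,
    gradInner_sub_left g hf hψ, gradInner_sub_left g hf hψ, gradInner_comm g ψ f, gradInner_self,
    gradInner_self]
  ring

theorem FiniteEnergy.of_compactSupport (g : Metric n M) {φ : M → ℝ} (hφ : Continuous φ) {ψ : M → Euc N}
    (hψ : ContMDiff 𝓘(ℝ, Euc n) 𝓘(ℝ, Euc N) ∞ ψ) (hc : HasCompactSupport ψ) :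
    FiniteEnergy g φ ψ := by
  have := isLocallyFiniteMeasure_weightedVolume g hφ
  refine ⟨hψ, ?_, ?_⟩
  · have h : Continuous fun x => ‖ψ x‖ ^ 2 := hψ.continuous.norm.pow 2
    exact h.integrable_of_hasCompactSupport (.of_support_subset_isCompact hc fun x hx =>
      subset_tsupport _ fun h0 => hx (by simp [h0]))
  · have h : Continuous (gradSq g ψ) := continuous_gradInner g hψ hψ
    exact h.integrable_of_hasCompactSupport
      (.of_support_subset_isCompact hc (support_gradInner_subset g ψ ψ))

omit [T2Space M] [SecondCountableTopology M] in
theorem FiniteEnergy.sub {g : Metric n M} {φ : M → ℝ} {f h : M → Euc N} (hf : FiniteEnergy g φ f)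
    (hh : FiniteEnergy g φ h) : FiniteEnergy g φ fun x => f x - h x := by
  have hs : ContMDiff 𝓘(ℝ, Euc n) 𝓘(ℝ, Euc N) ∞ fun x => f x - h x := hf.smooth.sub hh.smooth
  have h1 : Integrable (fun x => 2 * ‖f x‖ ^ 2 + 2 * ‖h x‖ ^ 2) (weightedVolume g φ) :=
    (hf.sq.const_mul 2).add (hh.sq.const_mul 2)
  have h2 : Integrable (fun x => 2 * gradSq g f x + 2 * gradSq g h x) (weightedVolume g φ) :=
    (hf.grad.const_mul 2).add (hh.grad.const_mul 2)
  have hc : Continuous fun x => ‖f x - h x‖ ^ 2 := hs.continuous.norm.pow 2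
  have hg : Continuous (gradSq g fun x => f x - h x) := continuous_gradInner g hs hs
  have hreal : ∀ {a b c : ℝ}, 0 ≤ c → c ≤ a + b → c ^ 2 ≤ 2 * a ^ 2 + 2 * b ^ 2 :=
    fun {a b c} h0 h => (pow_le_pow_left₀ h0 h 2).trans (by nlinarith [sq_nonneg (a - b)])
  have hreal' : ∀ {a b c : ℝ}, 0 ≤ a → 0 ≤ b → c ^ 2 ≤ a * b → a - 2 * c + b ≤ 2 * a + 2 * b :=
    fun {a b c} ha hb h => by
      have := abs_le_of_sq_le_sq' (a := c) (b := (a + b) / 2) (by nlinarith [sq_nonneg (a - b)])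
        (by positivity)
      linarith [this.1]
  refine ⟨hs, h1.mono' hc.aestronglyMeasurable (.of_forall fun x => ?_),
    h2.mono' hg.aestronglyMeasurable (.of_forall fun x => ?_)⟩
  · rw [Real.norm_of_nonneg (sq_nonneg _)]
    exact hreal (norm_nonneg _) (norm_sub_le (f x) (h x))
  · rw [Real.norm_of_nonneg (gradSq_nonneg g _ x), gradSq_sub g hf.smooth hh.smooth]
    exact hreal' (gradSq_nonneg g f x) (gradSq_nonneg g h x) (gradInner_sq_le g f h x)

omit [T2Space M] [SecondCountableTopology M] in
theorem FiniteEnergy.inner {g : Metric n M} {φ : M → ℝ} {f h : M → Euc N} (hf : FiniteEnergy g φ f)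
    (hh : FiniteEnergy g φ h) :
    Integrable (fun x => Inner.inner ℝ (f x) (h x)) (weightedVolume g φ) ∧
      |∫ x, Inner.inner ℝ (f x) (h x) ∂(weightedVolume g φ)| ≤
        √(∫ x, ‖f x‖ ^ 2 ∂(weightedVolume g φ)) * √(∫ x, ‖h x‖ ^ 2 ∂(weightedVolume g φ)) :=
  integrable_and_abs_integral_le (hf.smooth.continuous.inner hh.smooth.continuous).aestronglyMeasurable
    hf.sq hh.sq (fun _ => by positivity) (fun _ => by positivity) fun x => by
      rw [← mul_pow, ← sq_abs]
      exact pow_le_pow_left₀ (abs_nonneg _) (abs_real_inner_le_norm _ _) 2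

omit [T2Space M] [SecondCountableTopology M] in
theorem FiniteEnergy.gradInner {g : Metric n M} {φ : M → ℝ} {f h : M → Euc N} (hf : FiniteEnergy g φ f)
    (hh : FiniteEnergy g φ h) :
    Integrable (gradInner g f h) (weightedVolume g φ) ∧
      |∫ x, DriftHeat.gradInner g f h x ∂(weightedVolume g φ)| ≤
        √(∫ x, gradSq g f x ∂(weightedVolume g φ)) * √(∫ x, gradSq g h x ∂(weightedVolume g φ)) :=
  integrable_and_abs_integral_le (continuous_gradInner g hf.smooth hh.smooth).aestronglyMeasurable
    hf.grad hh.grad (gradSq_nonneg g f) (gradSq_nonneg g h) (gradInner_sq_le g f h)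

omit [T2Space M] [SecondCountableTopology M] in
theorem finiteEnergy_of_sobolevSq_lt_top {g : Metric n M} {φ : M → ℝ} {f : M → Euc N}
    (hf : ContMDiff 𝓘(ℝ, Euc n) 𝓘(ℝ, Euc N) ∞ f) (h : sobolevSq g φ f < ⊤) :
    FiniteEnergy g φ f ∧ ENNReal.ofReal (∫ x, ‖f x‖ ^ 2 ∂(weightedVolume g φ)) ≤ sobolevSq g φ f ∧
      ENNReal.ofReal (∫ x, gradSq g f x ∂(weightedVolume g φ)) ≤ sobolevSq g φ f := by
  have hc := hf.continuous.norm.pow 2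
  have hg := continuous_gradInner g hf hf
  have hnn : ∀ x, 0 ≤ ‖f x‖ ^ 2 + gradSq g f x := fun x => add_nonneg (by positivity) (gradSq_nonneg g f x)
  have hi : Integrable (fun x => ‖f x‖ ^ 2 + gradSq g f x) (weightedVolume g φ) :=
    ⟨(hc.add hg).aestronglyMeasurable,
      (hasFiniteIntegral_iff_ofReal (.of_forall hnn)).2 h⟩
  have h1 : Integrable (fun x => ‖f x‖ ^ 2) (weightedVolume g φ) :=
    hi.mono' hc.aestronglyMeasurable (.of_forall fun x => by
      rw [Real.norm_of_nonneg (by positivity)]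
      linarith [gradSq_nonneg g f x])
  have h2 : Integrable (gradSq g f) (weightedVolume g φ) :=
    hi.mono' hg.aestronglyMeasurable (.of_forall fun x => by
      rw [Real.norm_of_nonneg (gradSq_nonneg g f x)]
      linarith [sq_nonneg ‖f x‖])
  refine ⟨⟨hf, h1, h2⟩, ?_, ?_⟩
  · rw [ofReal_integral_eq_lintegral_ofReal h1 (.of_forall fun x => by positivity)]
    exact lintegral_mono fun x => ENNReal.ofReal_le_ofReal (by linarith [gradSq_nonneg g f x])
  · rw [ofReal_integral_eq_lintegral_ofReal h2 (.of_forall (gradSq_nonneg g f))]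
    exact lintegral_mono fun x => ENNReal.ofReal_le_ofReal (by linarith [sq_nonneg ‖f x‖])

/-- Approximation of an element of the Sobolev space by test functions. -/
theorem MemSobolev.exists_approx {g : Metric n M} {φ : M → ℝ} (hφ : Continuous φ) {f : M → Euc N}
    (hf : MemSobolev g φ f) {ε : ℝ} (hε : 0 < ε) :
    ∃ ψ : M → Euc N, ContMDiff 𝓘(ℝ, Euc n) 𝓘(ℝ, Euc N) ∞ ψ ∧ HasCompactSupport ψ ∧
      FiniteEnergy g φ ψ ∧ FiniteEnergy g φ (fun x => f x - ψ x) ∧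
      ∫ x, ‖f x - ψ x‖ ^ 2 ∂(weightedVolume g φ) ≤ ε ∧
      ∫ x, gradSq g (fun x => f x - ψ x) x ∂(weightedVolume g φ) ≤ ε := by
  obtain ⟨ψ, hψ, hc, hlt⟩ := hf.2 (ENNReal.ofReal ε) (ENNReal.ofReal_pos.2 hε)
  obtain ⟨h1, h2, h3⟩ := finiteEnergy_of_sobolevSq_lt_top (hf.1.sub hψ) (hlt.trans ENNReal.ofReal_lt_top)
  exact ⟨ψ, hψ, hc, .of_compactSupport g hφ hψ hc, h1,
    (ENNReal.ofReal_le_ofReal_iff hε.le).1 (h2.trans hlt.le),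
    (ENNReal.ofReal_le_ofReal_iff hε.le).1 (h3.trans hlt.le)⟩

theorem MemSobolev.finiteEnergy {g : Metric n M} {φ : M → ℝ} (hφ : Continuous φ) {f : M → Euc N}
    (hf : MemSobolev g φ f) : FiniteEnergy g φ f := by
  obtain ⟨ψ, hψ, -, h1, h2, -⟩ := hf.exists_approx hφ one_pos
  have h0 : FiniteEnergy g φ fun _ : M => (0 : Euc N) :=
    .of_compactSupport g hφ contMDiff_const .zero
  -- `f = (f - ψ) - (0 - ψ)` for any one approximant `ψ`.
  simpa using h2.sub (h0.sub h1)

/-- Green's formula for an element of the Sobolev space. -/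
theorem MemSobolev.integral_inner_driftLaplacian {g : Metric n M} {φ : M → ℝ}
    (hφ : ContMDiff 𝓘(ℝ, Euc n) 𝓘(ℝ, ℝ) ∞ φ) {w f v : M → Euc N} (hw : MemSobolev g φ w)
    (hf : FiniteEnergy g φ f) (hv : FiniteEnergy g φ v) (hfv : driftLaplacian g φ f = v) :
    ∫ x, Inner.inner ℝ (w x) (v x) ∂(weightedVolume g φ) =
      -∫ x, gradInner g w f x ∂(weightedVolume g φ) := by
  rw [← add_eq_zero_iff_eq_neg]
  -- Green's formula is exact for a test function `ψ`, so its defect for `w` equals its defect for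
  -- `w - ψ`, which Cauchy–Schwarz bounds by `√ε` times the norms of `v` and `∇f`.
  refine eq_zero_of_forall_abs_le_sqrt (K := √(∫ x, ‖v x‖ ^ 2 ∂(weightedVolume g φ)) +
    √(∫ x, gradSq g f x ∂(weightedVolume g φ))) fun ε hε => ?_
  obtain ⟨ψ, hψ, hc, hψe, hd, h1, h2⟩ := hw.exists_approx hφ.continuous hε
  have hwe := hw.finiteEnergy hφ.continuous
  have hG := DriftHeat.integral_inner_driftLaplacian g hφ hf.smooth hψ hc
  rw [hfv] at hG
  have e1 : ∫ x, Inner.inner ℝ (w x - ψ x) (v x) ∂(weightedVolume g φ) =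
      ∫ x, Inner.inner ℝ (w x) (v x) ∂(weightedVolume g φ) -
        ∫ x, Inner.inner ℝ (ψ x) (v x) ∂(weightedVolume g φ) := by
    simp only [inner_sub_left]
    exact integral_sub (hwe.inner hv).1 (hψe.inner hv).1
  have e2 : ∫ x, gradInner g (fun x => w x - ψ x) f x ∂(weightedVolume g φ) =
      ∫ x, gradInner g w f x ∂(weightedVolume g φ) -
        ∫ x, gradInner g ψ f x ∂(weightedVolume g φ) := by
    simp only [gradInner_sub_left g hwe.smooth hψ]
    exact integral_sub (hwe.gradInner hf).1 (hψe.gradInner hf).1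
  have e3 : ∫ x, Inner.inner ℝ (w x) (v x) ∂(weightedVolume g φ) +
      ∫ x, gradInner g w f x ∂(weightedVolume g φ) =
      ∫ x, Inner.inner ℝ (w x - ψ x) (v x) ∂(weightedVolume g φ) +
        ∫ x, gradInner g (fun x => w x - ψ x) f x ∂(weightedVolume g φ) := by
    rw [e1, e2, hG]
    ring
  rw [e3, mul_add]
  refine (abs_add_le _ _).trans (add_le_add ((hd.inner hv).2.trans ?_) ((hd.gradInner hf).2.trans ?_))
  · exact mul_le_mul_of_nonneg_right (Real.sqrt_le_sqrt h1) (Real.sqrt_nonneg _)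
  · exact mul_le_mul_of_nonneg_right (Real.sqrt_le_sqrt h2) (Real.sqrt_nonneg _)

end Sobolev

/-! ### Calculus of kernels that depend only on the sum of their arguments. -/

/-- A function on an open square whose partial derivatives both equal a Lipschitz function is constant
along antidiagonals. -/
theorem eq_midpoint_of_hasDerivAt {a b C : ℝ} {R f : ℝ → ℝ → ℝ} (hC : 0 ≤ C)
    (h1 : ∀ s ∈ Ioo a b, ∀ t ∈ Ioo a b, HasDerivAt (fun s => R s t) (f s t) s)
    (h2 : ∀ s ∈ Ioo a b, ∀ t ∈ Ioo a b, HasDerivAt (fun t => R s t) (f s t) t)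
    (hL : ∀ s ∈ Ioo a b, ∀ t ∈ Ioo a b, ∀ s' ∈ Ioo a b, ∀ t' ∈ Ioo a b,
      |f s t - f s' t'| ≤ C * (|s - s'| + |t - t'|))
    {s t : ℝ} (hs : s ∈ Ioo a b) (ht : t ∈ Ioo a b) :
    R s t = R ((s + t) / 2) ((s + t) / 2) := by
  -- Along an antidiagonal the first-order changes `h · f s t` and `-h · f s t` cancel. Subtracting
  -- the linear term in each variable, the Lipschitz bound leaves `2C|h| · |h|` for each of the two
  -- legs.
  have quad : ∀ s ∈ Ioo a b, ∀ t ∈ Ioo a b, ∀ h : ℝ, s + h ∈ Ioo a b → t - h ∈ Ioo a b →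
      |R (s + h) (t - h) - R s t| ≤ 4 * C * h ^ 2 := by
    intro s hs t ht h hsh hth
    have hsub : ∀ x ∈ Ioo a b, ∀ y ∈ Ioo a b, uIcc x y ⊆ Ioo a b := fun x hx y hy =>
      ordConnected_Ioo.uIcc_subset hx hy
    have hdist : ∀ x y z : ℝ, z ∈ uIcc x y → |z - x| ≤ |y - x| := fun x y z hz =>
      abs_sub_left_of_mem_uIcc hz
    have e1 := (convex_uIcc s (s + h)).norm_image_sub_le_of_norm_hasDerivWithin_le (𝕜 := ℝ)
      (f := fun r => R r (t - h) - r * f s t) (f' := fun r => f r (t - h) - f s t) (C := 2 * C * |h|)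
      (fun r hr => by
        have : HasDerivAt (fun r => R r (t - h) - r * f s t) (f r (t - h) - 1 * f s t) r :=
          (h1 r (hsub _ hs _ hsh hr) _ hth).sub ((hasDerivAt_id r).mul_const (f s t))
        simpa using this.hasDerivWithinAt) (fun r hr => by
        have h3 := hdist _ _ _ hr
        simp only [add_sub_cancel_left] at h3
        have h4 := hL r (hsub _ hs _ hsh hr) _ hth s hs t ht
        rw [show t - h - t = -h by ring, abs_neg] at h4
        rw [Real.norm_eq_abs]
        nlinarith) left_mem_uIcc right_mem_uIcc
    have e2 := (convex_uIcc t (t - h)).norm_image_sub_le_of_norm_hasDerivWithin_le (𝕜 := ℝ)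
      (f := fun r => R s r - r * f s t) (f' := fun r => f s r - f s t) (C := 2 * C * |h|)
      (fun r hr => by
        have : HasDerivAt (fun r => R s r - r * f s t) (f s r - 1 * f s t) r :=
          (h2 s hs r (hsub _ ht _ hth hr)).sub ((hasDerivAt_id r).mul_const (f s t))
        simpa using this.hasDerivWithinAt) (fun r hr => by
        have h3 := hdist _ _ _ hr
        rw [show t - h - t = -h by ring, abs_neg] at h3
        have h4 := hL s hs r (hsub _ ht _ hth hr) s hs t ht
        rw [sub_self, abs_zero, zero_add] at h4
        rw [Real.norm_eq_abs]
        nlinarith [abs_nonneg h]) left_mem_uIcc right_mem_uIcc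
    simp only [Real.norm_eq_abs, add_sub_cancel_left] at e1 e2
    rw [show t - h - t = -h by ring, abs_neg] at e2
    have e3 : R (s + h) (t - h) - R s t =
        (R (s + h) (t - h) - (s + h) * f s t - (R s (t - h) - s * f s t)) +
          (R s (t - h) - (t - h) * f s t - (R s t - t * f s t)) := by ring
    rw [e3]
    refine (abs_add_le _ _).trans ((add_le_add e1 e2).trans (le_of_eq ?_))
    rw [← sq_abs h]
    ring
  -- The antidiagonal is parametrised as `x ↦ (m + x, m - x)`, with the midpoint at `x = 0` and `(s,
  -- t)` at `x = d`.
  set m := (s + t) / 2 with hm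
  set d := (s - t) / 2 with hd
  set S : Set ℝ := {x | m + x ∈ Ioo a b ∧ m - x ∈ Ioo a b} with hS
  have hS0 : (0 : ℝ) ∈ S := by
    simp only [hS, mem_ofPred_eq, mem_Ioo] at *
    constructor <;> constructor <;> linarith [hs.1, hs.2, ht.1, ht.2]
  have hSd : d ∈ S := by
    simp only [hS, mem_ofPred_eq, mem_Ioo] at *
    constructor <;> constructor <;> linarith [hs.1, hs.2, ht.1, ht.2]
  have hSo : IsOpen S :=
    (isOpen_Ioo.preimage (by fun_prop : Continuous fun x : ℝ => m + x)).inter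
      (isOpen_Ioo.preimage (by fun_prop : Continuous fun x : ℝ => m - x))
  have hSc : Convex ℝ S := by
    refine (ordConnected_iff_uIcc_subset.2 fun x hx y hy z hz => ?_).convex
    obtain ⟨⟨x1, x2⟩, x3, x4⟩ := hx
    obtain ⟨⟨y1, y2⟩, y3, y4⟩ := hy
    rcases mem_uIcc.1 hz with ⟨z1, z2⟩ | ⟨z1, z2⟩ <;>
    exact ⟨⟨by linarith, by linarith⟩, by linarith, by linarith⟩
  have hderiv : ∀ x ∈ S, HasDerivWithinAt (fun x => R (m + x) (m - x)) 0 S x := by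
    intro x hx
    refine HasDerivAt.hasDerivWithinAt ?_
    rw [hasDerivAt_iff_isLittleO]
    have hO : (fun y => R (m + y) (m - y) - R (m + x) (m - x) - (y - x) • (0 : ℝ)) =O[nhds x]
        fun y => (y - x) ^ 2 := by
      refine Asymptotics.IsBigO.of_bound (4 * C) ?_
      filter_upwards [hSo.mem_nhds hx] with y hy
      have := quad _ hx.1 _ hx.2 (y - x) (by simpa using hy.1) (by
        rw [show m - x - (y - x) = m - y by ring]
        exact hy.2)
      rw [show m - x - (y - x) = m - y by ring, show m + x + (y - x) = m + y by ring] at this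
      rw [smul_zero, sub_zero, Real.norm_eq_abs, Real.norm_of_nonneg (sq_nonneg _)]
      exact this
    refine hO.trans_isLittleO ?_
    have := (Asymptotics.isLittleO_pow_id (𝕜 := ℝ) one_lt_two).comp_tendsto
      (k := fun y => y - x) (l' := nhds x) (by
        have : Continuous fun y : ℝ => y - x := by fun_prop
        simpa using this.tendsto x)
    exact this
  have := hSc.norm_image_sub_le_of_norm_hasDerivWithin_le (C := 0) hderiv (by simp) hS0 hSd
  rw [zero_mul, norm_le_zero_iff, sub_eq_zero] at this
  simp only [add_zero, sub_zero] at this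
  rw [← this]
  congr 1 <;> rw [hm, hd] <;> ring

/-- A symmetric kernel on a square, with symmetric and bounded first partial derivative, depends only
on the sum of its arguments. -/
theorem eq_midpoint_of_symm {a b C : ℝ} {f k : ℝ → ℝ → ℝ} (hab : a < b)
    (hf : ∀ s ∈ Icc a b, ∀ t ∈ Icc a b, f s t = f t s)
    (hk : ∀ s ∈ Icc a b, ∀ t ∈ Icc a b, k s t = k t s)
    (hd : ∀ s ∈ Icc a b, ∀ t ∈ Icc a b, HasDerivWithinAt (fun s => f s t) (k s t) (Icc a b) s)
    (hkc : ∀ t ∈ Icc a b, ContinuousOn (fun s => k s t) (Icc a b))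
    (hC : ∀ s ∈ Icc a b, ∀ t ∈ Icc a b, |k s t| ≤ C) {s t : ℝ} (hs : s ∈ Icc a b) (ht : t ∈ Icc a b) :
    f s t = f ((s + t) / 2) ((s + t) / 2) := by
  have hC0 : 0 ≤ C := (abs_nonneg _).trans (hC s hs t ht)
  have hL1 : ∀ t ∈ Icc a b, ∀ s ∈ Icc a b, ∀ s' ∈ Icc a b, |f s t - f s' t| ≤ C * |s - s'| :=
    fun t ht s hs s' hs' => (convex_Icc a b).norm_image_sub_le_of_norm_hasDerivWithin_le (𝕜 := ℝ)
      (f := fun s => f s t) (fun s hs => hd s hs t ht) (fun s hs => hC s hs t ht) hs' hs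
  have hL : ∀ s ∈ Icc a b, ∀ t ∈ Icc a b, ∀ s' ∈ Icc a b, ∀ t' ∈ Icc a b,
      |f s t - f s' t'| ≤ C * (|s - s'| + |t - t'|) := by
    intro s hs t ht s' hs' t' ht'
    have e1 := hL1 t ht s hs s' hs'
    have e2 := hL1 s' hs' t ht t' ht'
    rw [hf t ht s' hs', hf t' ht' s' hs'] at e2
    have e3 := abs_sub_le (f s t) (f s' t) (f s' t')
    linarith
  have hfc : ∀ t ∈ Icc a b, ContinuousOn (fun s => f s t) (Icc a b) := fun t ht s hs =>
    (hd s hs t ht).continuousWithinAt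
  have hIoo : ∀ {x}, x ∈ Ioo a b → x ∈ Icc a b := fun hx => Ioo_subset_Icc_self hx
  have hfi : ∀ t ∈ Icc a b, ∀ x ∈ Icc a b, IntervalIntegrable (fun s => f s t) volume a x :=
    fun t ht x hx => ((hfc t ht).mono (by
      rw [uIcc_of_le hx.1]
      exact Icc_subset_Icc_right hx.2)).intervalIntegrable
  have ha : a ∈ Icc a b := left_mem_Icc.2 hab.le
  -- Joint continuity of `k` is not available, so `f` itself is not differentiated along
  -- antidiagonals. `R` is a primitive whose two partial derivatives are both `f`, and `f` is
  -- Lipschitz.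
  set R : ℝ → ℝ → ℝ := fun s t => (∫ r in a..s, f r t) + ∫ r in a..t, f r a with hR
  have hftc : ∀ s ∈ Ioo a b, ∀ t ∈ Icc a b, HasDerivAt (fun s => ∫ r in a..s, f r t) (f s t) s := by
    intro s hs t ht
    have hn : Icc a b ∈ nhds s := Icc_mem_nhds hs.1 hs.2
    exact intervalIntegral.integral_hasDerivAt_right (hfi t ht s (hIoo hs))
      (ContinuousOn.stronglyMeasurableAtFilter_nhdsWithin (hfc t ht) measurableSet_Icc s |>.filter_mono
        (by rw [nhdsWithin_eq_nhds.2 hn]))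
      ((hfc t ht).continuousAt hn)
  have h1 : ∀ s ∈ Ioo a b, ∀ t ∈ Ioo a b, HasDerivAt (fun s => R s t) (f s t) s := fun s hs t ht => by
    exact (hftc s hs t (hIoo ht)).add_const (∫ r in a..t, f r a)
  have h2 : ∀ s ∈ Ioo a b, ∀ t ∈ Ioo a b, HasDerivAt (fun t => R s t) (f s t) t := by
    intro s hs t ht
    have hn : Ioo a b ∈ nhds t := Ioo_mem_nhds ht.1 ht.2
    have hsub : uIoc a s ⊆ Icc a b := by
      rw [uIoc_of_le hs.1.le]
      exact fun x hx => ⟨hx.1.le, hx.2.trans hs.2.le⟩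
    have hk1 : ContinuousOn (fun r => k r t) (Icc a s) :=
      (hkc t (hIoo ht)).mono (Icc_subset_Icc_right hs.2.le)
    have key := (intervalIntegral.hasDerivAt_integral_of_dominated_loc_of_deriv_le
      (F := fun τ r => f r τ) (F' := fun τ r => k r τ) (bound := fun _ => C) (x₀ := t) (a := a) (b := s)
      (μ := volume) hn (Filter.eventually_of_mem hn fun τ hτ =>
        ((hfc τ (hIoo hτ)).mono hsub).aestronglyMeasurable measurableSet_uIoc)
      (hfi t (hIoo ht) s (hIoo hs))
      (((hkc t (hIoo ht)).mono hsub).aestronglyMeasurable measurableSet_uIoc)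
      (.of_forall fun r hr τ hτ => hC r (hsub hr) τ (hIoo hτ)) intervalIntegrable_const
      (.of_forall fun r hr τ hτ => by
        have h := (hd τ (hIoo hτ) r (hsub hr)).hasDerivAt (Icc_mem_nhds hτ.1 hτ.2)
        rw [hk _ (hIoo hτ) _ (hsub hr)] at h
        refine h.congr_of_eventuallyEq ?_
        filter_upwards [Ioo_mem_nhds hτ.1 hτ.2] with x hx
        exact hf r (hsub hr) x (hIoo hx))).2
    -- The two symmetries make `k` the derivative of `f` in the second variable too, so the first
    -- term of `R` contributes `f s t - f a t`; the second term of `R` is chosen to restore `f a t`.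
    have hint : ∫ r in a..s, k r t = f s t - f a t :=
      intervalIntegral.integral_eq_sub_of_hasDerivAt_of_le hs.1.le
        ((hfc t (hIoo ht)).mono (Icc_subset_Icc_right hs.2.le))
        (fun r hr => (hd r ⟨hr.1.le, hr.2.le.trans hs.2.le⟩ t (hIoo ht)).hasDerivAt
          (Icc_mem_nhds hr.1 (hr.2.trans hs.2)))
        (ContinuousOn.intervalIntegrable (by rwa [uIcc_of_le hs.1.le]))
    have h3 := key.add (hftc t ht a ha)
    rw [hint, hf a ha t (hIoo ht), sub_add_cancel] at h3
    exact h3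
  have hRm : ∀ {s t : ℝ}, s ∈ Ioo a b → t ∈ Ioo a b → R s t = R ((s + t) / 2) ((s + t) / 2) :=
    fun hs ht => eq_midpoint_of_hasDerivAt hC0 h1 h2
      (fun s hs t ht s' hs' t' ht' => hL s (hIoo hs) t (hIoo ht) s' (hIoo hs') t' (hIoo ht')) hs ht
  have hint : ∀ s ∈ Ioo a b, ∀ t ∈ Ioo a b, f s t = f ((s + t) / 2) ((s + t) / 2) := by
    intro s hs t ht
    have hm : (s + t) / 2 ∈ Ioo a b := ⟨by linarith [hs.1, ht.1], by linarith [hs.2, ht.2]⟩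
    -- With `m = (s + t) / 2`, the points `(s + h, t)` and `(m + h, m)` lie on a common
    -- antidiagonal, so `R` agrees there, and so do the derivatives at `h = 0`.
    have d1 : HasDerivAt (fun h => R (s + h) t) (f s t) 0 := by
      have := (h1 s hs t ht)
      exact HasDerivAt.comp_const_add s 0 (by simpa using this)
    have d2 : HasDerivAt (fun h => R ((s + t) / 2 + h) ((s + t) / 2))
        (f ((s + t) / 2) ((s + t) / 2)) 0 := by
      have := (h1 _ hm _ hm)
      exact HasDerivAt.comp_const_add ((s + t) / 2) 0 (by simpa using this)
    refine d1.unique (d2.congr_of_eventuallyEq ?_)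
    have c1 : ∀ x ∈ Ioo a b, ∀ᶠ h in nhds (0 : ℝ), x + h ∈ Ioo a b := fun x hx =>
      (by fun_prop : Continuous fun h : ℝ => x + h).continuousAt.eventually_mem
        (by simpa using Ioo_mem_nhds hx.1 hx.2)
    filter_upwards [c1 s hs, c1 _ hm] with h hh1 hh2
    rw [hRm hh1 ht, hRm hh2 hm]
    congr 1 <;> ring
  set c := (a + b) / 2 with hc
  -- Boundary points are pulled towards the centre `c` by an affine map, which commutes with taking
  -- midpoints. Four coordinates move by at most `ε (b - a)` each, whence the factor 4.
  have hapx : ∀ ε ∈ Ioo (0 : ℝ) 1, |f s t - f ((s + t) / 2) ((s + t) / 2)| ≤ 4 * C * (b - a) * ε := by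
    intro ε hε
    have hin : ∀ x ∈ Icc a b, x + ε * (c - x) ∈ Ioo a b ∧ |x - (x + ε * (c - x))| ≤ ε * (b - a) := by
      intro x hx
      refine ⟨⟨?_, ?_⟩, ?_⟩
      · nlinarith [hε.1, hε.2, hx.1, hx.2, mul_pos hε.1 (sub_pos.2 hab),
          mul_nonneg (sub_pos.2 hε.2).le (sub_nonneg.2 hx.1)]
      · nlinarith [hε.1, hε.2, hx.1, hx.2, mul_pos hε.1 (sub_pos.2 hab),
          mul_nonneg (sub_pos.2 hε.2).le (sub_nonneg.2 hx.2)]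
      · rw [show x - (x + ε * (c - x)) = ε * (x - c) by ring, abs_mul, abs_of_pos hε.1]
        refine mul_le_mul_of_nonneg_left (abs_le.2 ⟨?_, ?_⟩) hε.1.le <;> linarith [hx.1, hx.2]
    have hm : (s + t) / 2 ∈ Icc a b := ⟨by linarith [hs.1, ht.1], by linarith [hs.2, ht.2]⟩
    obtain ⟨s1, s2⟩ := hin s hs
    obtain ⟨t1, t2⟩ := hin t ht
    obtain ⟨m1, m2⟩ := hin _ hm
    have e1 := hL s hs t ht _ (hIoo s1) _ (hIoo t1)
    have e2 := hL _ hm _ hm _ (hIoo m1) _ (hIoo m1)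
    have e3 := hint _ s1 _ t1
    rw [show (s + ε * (c - s) + (t + ε * (c - t))) / 2 = (s + t) / 2 + ε * (c - (s + t) / 2) by ring] at e3
    rw [e3] at e1
    rw [abs_sub_comm] at e2
    have e4 := abs_sub_le (f s t) (f ((s + t) / 2 + ε * (c - (s + t) / 2))
      ((s + t) / 2 + ε * (c - (s + t) / 2))) (f ((s + t) / 2) ((s + t) / 2))
    nlinarith
  have hlim : Filter.Tendsto (fun ε : ℝ => 4 * C * (b - a) * ε) (nhdsWithin 0 (Ioi 0)) (nhds 0) := by
    have : Continuous fun ε : ℝ => 4 * C * (b - a) * ε := by fun_prop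
    simpa using (this.tendsto 0).mono_left nhdsWithin_le_nhds
  have := ge_of_tendsto hlim (Filter.eventually_of_mem (Ioo_mem_nhdsGT one_pos) hapx)
  exact sub_eq_zero.1 (abs_nonpos_iff.1 this)

/-- The derivative along the diagonal of a kernel depending only on the sum of its arguments. -/
theorem hasDerivWithinAt_diag {a b : ℝ} {F : ℝ → ℝ → ℝ}
    (hF : ∀ s ∈ Icc a b, ∀ t ∈ Icc a b, F s t = F ((s + t) / 2) ((s + t) / 2)) {t G : ℝ}
    (ht : t ∈ Icc a b) (hd : HasDerivWithinAt (fun s => F s t) G (Icc a b) t) :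
    HasDerivWithinAt (fun τ => F τ τ) (2 * G) (Icc a b) t := by
  -- Since only the sum matters, `F τ τ = F (2τ - t) t`, which explains the factor 2. The constraint
  -- that `2τ - t` stay in the interval holds near `t` within `[a, b]`, even at the end points.
  set S : Set ℝ := {τ | 2 * τ - t ∈ Icc a b} with hS
  have hSn : S ∈ nhdsWithin t (Icc a b) := by
    have h1 : ∀ᶠ τ in nhdsWithin t (Icc a b), a ≤ 2 * τ - t := by
      rcases ht.1.eq_or_lt with h | h
      · filter_upwards [self_mem_nhdsWithin] with τ hτ
        linarith [hτ.1]
      · filter_upwards [mem_nhdsWithin_of_mem_nhds (Ioi_mem_nhds (show (a + t) / 2 < t by linarith))]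
          with τ hτ
        linarith [mem_Ioi.1 hτ]
    have h2 : ∀ᶠ τ in nhdsWithin t (Icc a b), 2 * τ - t ≤ b := by
      rcases ht.2.eq_or_lt with h | h
      · filter_upwards [self_mem_nhdsWithin] with τ hτ
        linarith [hτ.2]
      · filter_upwards [mem_nhdsWithin_of_mem_nhds (Iio_mem_nhds (show t < (b + t) / 2 by linarith))]
          with τ hτ
        linarith [mem_Iio.1 hτ]
    exact h1.and h2
  have hin : HasDerivWithinAt (fun τ : ℝ => 2 * τ - t) 2 (S ∩ Icc a b) t := by
    simpa using (((hasDerivAt_id t).const_mul 2).sub_const t).hasDerivWithinAt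
  have hcomp := HasDerivWithinAt.scomp (h := fun τ : ℝ => 2 * τ - t) (g₁ := fun s => F s t)
    (t' := Icc a b) t (by rwa [show 2 * t - t = t by ring]) hin (fun τ hτ => hτ.1)
  have h3 : HasDerivWithinAt (fun τ => F τ τ) (2 * G) (S ∩ Icc a b) t := by
    refine hcomp.congr (fun τ hτ => ?_) ?_
    · rw [Function.comp_apply, hF _ hτ.1 _ ht]
      congr 1 <;> ring
    · simp only [Function.comp_apply]
      congr 1
      ring
  exact h3.mono_of_mem_nhdsWithin (Filter.inter_mem hSn self_mem_nhdsWithin)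

/-- The derivative of a kernel depending only on the sum of its arguments has the same property. -/
theorem deriv_eq_midpoint {a b : ℝ} {f k : ℝ → ℝ → ℝ}
    (hf : ∀ s ∈ Icc a b, ∀ t ∈ Icc a b, f s t = f ((s + t) / 2) ((s + t) / 2))
    (hk : ∀ s ∈ Icc a b, ∀ t ∈ Icc a b, k s t = k t s)
    (hd : ∀ s ∈ Icc a b, ∀ t ∈ Icc a b, HasDerivWithinAt (fun s => f s t) (k s t) (Icc a b) s) :
    ∀ s ∈ Icc a b, ∀ t ∈ Icc a b, k s t = k ((s + t) / 2) ((s + t) / 2) := by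
  have main : ∀ s ∈ Icc a b, ∀ t ∈ Icc a b, s < t → k s t = k ((s + t) / 2) ((s + t) / 2) := by
    intro s hs t ht hst
    set m := (s + t) / 2 with hm
    have hsm : s < m := by linarith
    have hmt : m < t := by linarith
    have hmI : m ∈ Icc a b := ⟨by linarith [hs.1], by linarith [ht.2]⟩
    -- One-sided shifts suffice: `m < t ≤ b` leaves room for `h ≥ 0`, and `f (s + h) t = f (m + h)
    -- m` because the sums agree. This covers `s = a` as well.
    have hshift : ∀ x ∈ Icc a b, x ≤ m → ∀ y ∈ Icc a b,
        HasDerivWithinAt (fun h => f (x + h) y) (k x y) (Icc 0 (b - m)) 0 := by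
      intro x hx hxm y hy
      have h1 : HasDerivWithinAt ((fun s => f s y) ∘ fun h => x + h) ((1 : ℝ) • k x y)
          (Icc 0 (b - m)) 0 := HasDerivWithinAt.scomp (h := fun h : ℝ => x + h) (g₁ := fun s => f s y)
        (t' := Icc a b) (s := Icc 0 (b - m)) (h' := 1) (g₁' := k x y) 0
        (by simpa using hd x hx y hy)
        (by simpa using ((hasDerivAt_id (0 : ℝ)).const_add x).hasDerivWithinAt)
        (fun h hh => ⟨by linarith [hx.1, hh.1], by linarith [hh.2]⟩)
      rw [one_smul] at h1
      exact h1
    have d1 := hshift s hs hsm.le t ht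
    have d2 := hshift m hmI le_rfl m hmI
    have hu : UniqueDiffWithinAt ℝ (Icc 0 (b - m)) 0 :=
      uniqueDiffOn_Icc (by linarith [ht.2]) 0 (left_mem_Icc.2 (by linarith [ht.2]))
    have heq : ∀ h ∈ Icc 0 (b - m), f (s + h) t = f (m + h) m := by
      intro h hh
      rw [hf (s + h) ⟨by linarith [hs.1, hh.1], by linarith [hh.2]⟩ t ht,
        hf (m + h) ⟨by linarith [hmI.1, hh.1], by linarith [hh.2]⟩ m hmI]
      congr 1 <;> ring
    exact hu.eq_deriv _ d1 (d2.congr heq (heq 0 (left_mem_Icc.2 (by linarith [ht.2]))))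
  intro s hs t ht
  rcases lt_trichotomy s t with h | h | h
  · exact main s hs t ht h
  · subst h
    congr 1 <;> ring
  · rw [hk s hs t ht, add_comm, main t ht s hs h]

/-- A uniform limit of functions given by integrals of uniformly convergent continuous functions is
differentiable up to the end points. -/
theorem hasDerivWithinAt_of_approx {a b : ℝ} (hab : a < b) {F G : ℝ → ℝ}
    (happ : ∀ ε > 0, ∃ F' G' : ℝ → ℝ, ContinuousOn G' (Icc a b) ∧
      (∀ t ∈ Icc a b, F' t - F' a = ∫ r in a..t, G' r) ∧
      ∀ t ∈ Icc a b, |F t - F' t| ≤ ε ∧ |G t - G' t| ≤ ε) :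
    ContinuousOn G (Icc a b) ∧ ∀ t ∈ Icc a b, HasDerivWithinAt F (G t) (Icc a b) t := by
  have hG : ContinuousOn G (Icc a b) := by
    refine continuousOn_of_uniform_approx_of_continuousOn fun V hV => ?_
    obtain ⟨ε, hε, hV⟩ := Metric.mem_uniformity_dist.1 hV
    obtain ⟨F', G', hc, -, h⟩ := happ (ε / 2) (half_pos hε)
    exact ⟨G', hc, fun t ht => hV ((h t ht).2.trans_lt (half_lt_self hε))⟩
  have hsub : ∀ t ∈ Icc a b, uIcc a t ⊆ Icc a b := fun t ht => by
    rw [uIcc_of_le ht.1]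
    exact Icc_subset_Icc_right ht.2
  have hint : ∀ {G : ℝ → ℝ}, ContinuousOn G (Icc a b) → ∀ t ∈ Icc a b,
      IntervalIntegrable G volume a t := fun hG t ht => (hG.mono (hsub t ht)).intervalIntegrable
  -- The integral identity survives uniform limits. Primes mark the approximants here, not
  -- derivatives.
  have hF : ∀ t ∈ Icc a b, F t - F a = ∫ r in a..t, G r := by
    intro t ht
    rw [← sub_eq_zero]
    refine eq_zero_of_forall_abs_le_sqrt (K := 2 + (b - a)) fun ε hε => ?_
    obtain ⟨F', G', hc, hi, h⟩ := happ (√ε) (Real.sqrt_pos.2 hε)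
    have e1 : F t - F a - ∫ r in a..t, G r =
        (F t - F' t) - (F a - F' a) - ∫ r in a..t, (G r - G' r) := by
      rw [intervalIntegral.integral_sub (hint hG t ht) (hint hc t ht), ← hi t ht]
      ring
    have e2 : |∫ r in a..t, (G r - G' r)| ≤ √ε * |t - a| := by
      rw [← Real.norm_eq_abs]
      exact intervalIntegral.norm_integral_le_of_norm_le_const fun r hr =>
        (h r (hsub t ht (uIoc_subset_uIcc hr))).2
    rw [abs_of_nonneg (sub_nonneg.2 ht.1)] at e2
    have e3 := (h t ht).1
    have e4 := (h a (left_mem_Icc.2 hab.le)).1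
    rw [e1]
    have e5 := abs_sub ((F t - F' t) - (F a - F' a)) (∫ r in a..t, (G r - G' r))
    have e6 := abs_sub (F t - F' t) (F a - F' a)
    have e7 : √ε * (t - a) ≤ √ε * (b - a) :=
      mul_le_mul_of_nonneg_left (by linarith [ht.2]) (Real.sqrt_nonneg _)
    linarith
  refine ⟨hG, fun t ht => ?_⟩
  have : Fact (t ∈ Icc a b) := ⟨ht⟩
  have hd : HasDerivWithinAt (fun t => ∫ r in a..t, G r) (G t) (Icc a b) t :=
    intervalIntegral.integral_hasDerivWithinAt_right (hint hG t ht)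
      (hG.stronglyMeasurableAtFilter_nhdsWithin measurableSet_Icc t) (hG t ht)
  refine (hd.const_add (F a)).congr (fun s hs => ?_) ?_
  · rw [← hF s hs]
    ring
  · rw [← hF t ht]
    ring

/-! ### Time derivatives and integrals against test functions. -/

section TimeDerivative

variable {n N : ℕ} {M : Type*} [TopologicalSpace M] [ChartedSpace (Euc n) M]
  [IsManifold 𝓘(ℝ, Euc n) ∞ M]

theorem contDiffOn_prod_chart_symm {a b : ℝ} {u : M → ℝ → Euc N}
    (hu : ContMDiffOn (𝓘(ℝ, Euc n).prod 𝓘(ℝ, ℝ)) 𝓘(ℝ, Euc N) ∞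
      (fun p : M × ℝ => u p.1 p.2) (univ ×ˢ Icc a b)) (p : M) :
    ContDiffOn ℝ ∞ (fun q : Euc n × ℝ => u ((chartAt (Euc n) p).symm q.1) q.2)
      ((chartAt (Euc n) p).target ×ˢ Icc a b) := by
  have h1 : ContMDiffOn (𝓘(ℝ, Euc n).prod 𝓘(ℝ, ℝ)) (𝓘(ℝ, Euc n).prod 𝓘(ℝ, ℝ)) ∞
      (fun q : Euc n × ℝ => ((chartAt (Euc n) p).symm q.1, q.2))
      ((chartAt (Euc n) p).target ×ˢ Icc a b) :=
    ((contMDiffOn_chart_symm (I := 𝓘(ℝ, Euc n)) (x := p) (n := ∞)).comp contMDiffOn_fst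
      fun q hq => hq.1).prodMk contMDiffOn_snd
  have h2 := hu.comp h1 fun q hq => ⟨mem_univ _, hq.2⟩
  rw [← modelWithCornersSelf_prod, chartedSpaceSelf_prod] at h2
  exact h2.contDiffOn

omit [IsManifold 𝓘(ℝ, Euc n) ∞ M] in
theorem continuousOn_of_forall_chart {F : Type*} [TopologicalSpace F] {S : Set ℝ} {f : M × ℝ → F}
    (h : ∀ p : M, ContinuousOn (fun q : Euc n × ℝ => f ((chartAt (Euc n) p).symm q.1, q.2))
      ((chartAt (Euc n) p).target ×ˢ S)) : ContinuousOn f (univ ×ˢ S) := by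
  rintro ⟨x, t⟩ ⟨-, ht⟩
  have hx := mem_chart_source (Euc n) x
  have h1 : ContinuousOn (fun q : M × ℝ => (chartAt (Euc n) x q.1, q.2))
      ((chartAt (Euc n) x).source ×ˢ S) :=
    ((chartAt (Euc n) x).continuousOn.comp continuousOn_fst fun q hq => hq.1).prodMk continuousOn_snd
  have h2 : ContinuousOn f ((chartAt (Euc n) x).source ×ˢ S) :=
    ((h x).comp h1 fun q hq => ⟨(chartAt (Euc n) x).map_source hq.1, hq.2⟩).congr fun q hq => by
      simp [(chartAt (Euc n) x).left_inv hq.1]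
  refine (h2 (x, t) ⟨hx, ht⟩).mono_of_mem_nhdsWithin ?_
  rw [nhdsWithin_prod_eq, nhdsWithin_univ]
  exact Filter.prod_mem_prod ((chartAt (Euc n) x).open_source.mem_nhds hx) self_mem_nhdsWithin

/-- Time differentiability and joint continuity of the time derivative. -/
theorem continuousOn_timeDeriv {a b : ℝ} (hab : a < b) {u : M → ℝ → Euc N}
    (hu : ContMDiffOn (𝓘(ℝ, Euc n).prod 𝓘(ℝ, ℝ)) 𝓘(ℝ, Euc N) ∞
      (fun p : M × ℝ => u p.1 p.2) (univ ×ˢ Icc a b)) :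
    (∀ x, ∀ t ∈ Icc a b, HasDerivWithinAt (u x) (timeDeriv a b u x t) (Icc a b) t) ∧
      ContinuousOn (fun p : M × ℝ => timeDeriv a b u p.1 p.2) (univ ×ˢ Icc a b) := by
  have hd : ∀ p : M, ∀ z ∈ (chartAt (Euc n) p).target, ∀ t ∈ Icc a b,
      HasDerivWithinAt (u ((chartAt (Euc n) p).symm z))
        (fderivWithin ℝ (fun q : Euc n × ℝ => u ((chartAt (Euc n) p).symm q.1) q.2)
          ((chartAt (Euc n) p).target ×ˢ Icc a b) (z, t) (0, 1)) (Icc a b) t := by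
    intro p z hz t ht
    have h1 := ((contDiffOn_prod_chart_symm hu p).differentiableOn (by simp) (z, t)
      ⟨hz, ht⟩).hasFDerivWithinAt
    have h2 : HasDerivWithinAt (fun s : ℝ => (z, s)) ((0 : Euc n), (1 : ℝ)) (Icc a b) t :=
      (hasDerivWithinAt_const t _ z).prodMk (hasDerivWithinAt_id t _)
    exact h1.comp_hasDerivWithinAt t h2 fun s hs => ⟨hz, hs⟩
  have hu1 := uniqueDiffOn_Icc hab
  have hder : ∀ p : M, ∀ z ∈ (chartAt (Euc n) p).target, ∀ t ∈ Icc a b,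
      timeDeriv a b u ((chartAt (Euc n) p).symm z) t =
        fderivWithin ℝ (fun q : Euc n × ℝ => u ((chartAt (Euc n) p).symm q.1) q.2)
          ((chartAt (Euc n) p).target ×ˢ Icc a b) (z, t) (0, 1) :=
    fun p z hz t ht => (hd p z hz t ht).derivWithin (hu1 t ht)
  refine ⟨fun x t ht => ?_, continuousOn_of_forall_chart (n := n) fun p => ?_⟩
  · have hx := mem_chart_source (Euc n) x
    have h := hd x _ ((chartAt (Euc n) x).map_source hx) t ht
    rw [← hder x _ ((chartAt (Euc n) x).map_source hx) t ht, (chartAt (Euc n) x).left_inv hx] at h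
    exact h
  · refine ContinuousOn.congr ?_ fun q hq => hder p q.1 hq.1 q.2 hq.2
    exact ((contDiffOn_prod_chart_symm hu p).continuousOn_fderivWithin
      ((chartAt (Euc n) p).open_target.uniqueDiffOn.prod hu1) (by simp)).clm_apply continuousOn_const

end TimeDerivative

/-- Differentiation under the integral sign, against a compactly supported function. -/
theorem integral_inner_sub_eq_integral {X : Type*} [TopologicalSpace X] [MeasurableSpace X]
    [BorelSpace X] {μ : Measure X} [IsFiniteMeasureOnCompacts μ] {N : ℕ} {a b : ℝ}
    {u v : X → ℝ → Euc N} {ψ : X → Euc N}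
    (hu : ContinuousOn (fun p : X × ℝ => u p.1 p.2) (univ ×ˢ Icc a b))
    (hv : ContinuousOn (fun p : X × ℝ => v p.1 p.2) (univ ×ˢ Icc a b))
    (hd : ∀ x, ∀ t ∈ Icc a b, HasDerivWithinAt (u x) (v x t) (Icc a b) t)
    (hψ : Continuous ψ) (hc : HasCompactSupport ψ) [T2Space X] :
    ContinuousOn (fun t => ∫ x, inner ℝ (v x t) (ψ x) ∂μ) (Icc a b) ∧
      ∀ t ∈ Icc a b, ∫ x, inner ℝ (u x t) (ψ x) ∂μ - ∫ x, inner ℝ (u x a) (ψ x) ∂μ =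
        ∫ r in a..t, ∫ x, inner ℝ (v x r) (ψ x) ∂μ := by
  have hcont : ∀ {w : X → ℝ → Euc N}, ContinuousOn (fun p : X × ℝ => w p.1 p.2) (univ ×ˢ Icc a b) →
      ContinuousOn (fun p : ℝ × X => inner ℝ (w p.2 p.1) (ψ p.2)) (Icc a b ×ˢ univ) := fun hw =>
    ContinuousOn.inner (𝕜 := ℝ) (hw.comp continuous_swap.continuousOn fun p hp => ⟨hp.2, hp.1⟩)
      (hψ.comp continuous_snd).continuousOn
  have hzero : ∀ (w : X → ℝ → Euc N) (t : ℝ) (x : X), x ∉ tsupport ψ → inner ℝ (w x t) (ψ x) = 0 :=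
    fun w t x hx => by rw [image_eq_zero_of_notMem_tsupport hx, inner_zero_right]
  have hint : ∀ {w : X → ℝ → Euc N}, ContinuousOn (fun p : X × ℝ => w p.1 p.2) (univ ×ˢ Icc a b) →
      ContinuousOn (fun t => ∫ x, inner ℝ (w x t) (ψ x) ∂μ) (Icc a b) := fun {w} hw =>
    continuousOn_integral_of_compact_support (f := fun t x => inner ℝ (w x t) (ψ x)) hc (hcont hw)
      fun t x _ hx => hzero w t x hx
  have hsl : ∀ {w : X → ℝ → Euc N}, ContinuousOn (fun p : X × ℝ => w p.1 p.2) (univ ×ˢ Icc a b) →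
      ∀ t ∈ Icc a b, Continuous fun x => inner ℝ (w x t) (ψ x) := fun {w} hw t ht => by
    rw [← continuousOn_univ]
    exact (hcont hw).comp (f := fun x => (t, x)) (by fun_prop) fun x _ => ⟨ht, mem_univ _⟩
  have hsi : ∀ {w : X → ℝ → Euc N}, ContinuousOn (fun p : X × ℝ => w p.1 p.2) (univ ×ˢ Icc a b) →
      ∀ t ∈ Icc a b, Integrable (fun x => inner ℝ (w x t) (ψ x)) μ := fun {w} hw t ht =>
    (hsl hw t ht).integrable_of_hasCompactSupport
      (.of_support_subset_isCompact hc fun x hx => by_contra fun h => hx (hzero w t x h))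
  refine ⟨hint hv, fun t ht => ?_⟩
  obtain ⟨C, hC⟩ := (isCompact_Icc.prod hc).exists_bound_of_continuousOn
    ((hcont hv).mono (prod_mono subset_rfl (subset_univ _)))
  have hI : Icc a t ⊆ Icc a b := Icc_subset_Icc_right ht.2
  refine (intervalIntegral.integral_eq_sub_of_hasDerivAt_of_le ht.1 ((hint hu).mono hI)
    (fun r hr => ?_) (((hint hv).mono (by rwa [uIcc_of_le ht.1])).intervalIntegrable)).symm
  have hr' : r ∈ Ioo a b := ⟨hr.1, hr.2.trans_le ht.2⟩
  have hIoo : ∀ {s}, s ∈ Ioo a b → s ∈ Icc a b := fun hs => Ioo_subset_Icc_self hs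
  have hn : Ioo a b ∈ nhds r := Ioo_mem_nhds hr'.1 hr'.2
  refine (hasDerivAt_integral_of_dominated_loc_of_deriv_le (μ := μ)
    (F := fun s x => inner ℝ (u x s) (ψ x)) (F' := fun s x => inner ℝ (v x s) (ψ x))
    (bound := (tsupport ψ).indicator fun _ => C) hn
    (Filter.eventually_of_mem hn fun s hs => (hsi hu s (hIoo hs)).aestronglyMeasurable)
    (hsi hu r (hIoo hr')) (hsi hv r (hIoo hr')).aestronglyMeasurable
    (.of_forall fun x s hs => ?_) ?_ (.of_forall fun x s hs => ?_)).2
  · by_cases hx : x ∈ tsupport ψ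
    · rw [indicator_of_mem hx]
      exact hC (s, x) ⟨hIoo hs, hx⟩
    · rw [hzero v s x hx, indicator_of_notMem hx, norm_zero]
  · rw [integrable_indicator_iff (isClosed_tsupport ψ).measurableSet]
    exact integrableOn_const hc.measure_lt_top.ne
  · have h := ((hd x s (hIoo hs)).hasDerivAt (Icc_mem_nhds hs.1 hs.2)).inner ℝ
      (hasDerivAt_const s (ψ x))
    simpa using h

/-! ### Positivity, monotonicity and the rigidity equation. -/

/-- A midpoint log-convex function that vanishes somewhere vanishes identically. -/
theorem pos_of_sq_midpoint_le {a b : ℝ} {J : ℝ → ℝ} (hJ : ContinuousOn J (Icc a b))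
    (h0 : ∀ t ∈ Icc a b, 0 ≤ J t)
    (hm : ∀ s ∈ Icc a b, ∀ t ∈ Icc a b, J ((s + t) / 2) ^ 2 ≤ J s * J t) {t₀ : ℝ} (ht₀ : t₀ ∈ Icc a b)
    (hne : J t₀ ≠ 0) : ∀ t ∈ Icc a b, 0 < J t := by
  by_contra! hcon
  obtain ⟨z₀, hz₀, hz₀'⟩ := hcon
  -- Take the zero of `J` nearest to `t₀`; the midpoint inequality makes the point halfway to `t₀` a
  -- zero too, a contradiction.
  have hZ : IsCompact (Icc a b ∩ J ⁻¹' {0}) :=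
    isCompact_Icc.of_isClosed_subset (hJ.preimage_isClosed_of_isClosed isClosed_Icc isClosed_singleton)
      inter_subset_left
  obtain ⟨z, ⟨hz, hz0⟩, hmin⟩ := hZ.exists_isMinOn ⟨z₀, hz₀, le_antisymm hz₀' (h0 z₀ hz₀)⟩
    (f := fun z => |z - t₀|) (by fun_prop)
  have hzJ : J z = 0 := hz0
  have hmid : (z + t₀) / 2 ∈ Icc a b := ⟨by linarith [hz.1, ht₀.1], by linarith [hz.2, ht₀.2]⟩
  have h1 := hm z hz t₀ ht₀
  rw [hzJ, zero_mul] at h1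
  have h2 : J ((z + t₀) / 2) = 0 := pow_eq_zero_iff two_ne_zero |>.1 (le_antisymm h1 (sq_nonneg _))
  have h3 : |z - t₀| ≤ |(z + t₀) / 2 - t₀| := hmin ⟨hmid, h2⟩
  rw [show (z + t₀) / 2 - t₀ = (z - t₀) / 2 by ring, abs_div, abs_two] at h3
  have h4 : 0 < |z - t₀| := abs_pos.2 (sub_ne_zero.2 fun h => hne (h ▸ hzJ))
  linarith

/-- The consequences of `I' = 2D`, `D' = 2E` and `D² ≤ I E` for the quotient `D / I`. -/
theorem frequency_monotone {a b : ℝ} {J D E : ℝ → ℝ} (hpos : ∀ t ∈ Icc a b, 0 < J t)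
    (hJ : ∀ t ∈ Icc a b, HasDerivWithinAt J (2 * D t) (Icc a b) t)
    (hD : ∀ t ∈ Icc a b, HasDerivWithinAt D (2 * E t) (Icc a b) t)
    (hcs : ∀ t ∈ Icc a b, D t ^ 2 ≤ J t * E t) :
    (∀ t ∈ Icc a b, HasDerivWithinAt (fun s => Real.log (J s)) (2 * (D t / J t)) (Icc a b) t) ∧
    (∀ t ∈ Icc a b, HasDerivWithinAt (fun s => D s / J s)
      (2 * (J t * E t - D t ^ 2) / J t ^ 2) (Icc a b) t) ∧
    MonotoneOn (fun s => D s / J s) (Icc a b) ∧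
    ConvexOn ℝ (Icc a b) (fun s => Real.log (J s)) := by
  have hlog : ∀ t ∈ Icc a b,
      HasDerivWithinAt (fun s => Real.log (J s)) (2 * (D t / J t)) (Icc a b) t := fun t ht => by
    rw [← mul_div_assoc]
    exact (hJ t ht).log (hpos t ht).ne'
  have hU : ∀ t ∈ Icc a b, HasDerivWithinAt (fun s => D s / J s)
      (2 * (J t * E t - D t ^ 2) / J t ^ 2) (Icc a b) t := fun t ht => by
    rw [show 2 * (J t * E t - D t ^ 2) / J t ^ 2 = (2 * E t * J t - D t * (2 * D t)) / J t ^ 2 by ring]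
    exact (hD t ht).div (hJ t ht) (hpos t ht).ne'
  have hmono : MonotoneOn (fun s => D s / J s) (Icc a b) := by
    refine monotoneOn_of_hasDerivWithinAt_nonneg (convex_Icc a b)
      (fun t ht => (hU t ht).continuousWithinAt)
      (fun t ht => (hU t (interior_subset ht)).mono interior_subset) fun t ht => ?_
    have h1 := hcs t (interior_subset ht)
    exact div_nonneg (by linarith) (sq_nonneg _)
  refine ⟨hlog, hU, hmono, MonotoneOn.convexOn_of_deriv (convex_Icc a b)
    (fun t ht => (hlog t ht).continuousWithinAt) (fun t ht =>
      ((hlog t (interior_subset ht)).mono interior_subset).differentiableWithinAt) ?_⟩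
  have hderiv : ∀ t ∈ interior (Icc a b), deriv (fun s => Real.log (J s)) t = 2 * (D t / J t) :=
    fun t ht => ((hlog t (interior_subset ht)).hasDerivAt (mem_interior_iff_mem_nhds.1 ht)).deriv
  intro s hs t ht hst
  rw [hderiv s hs, hderiv t ht]
  exact mul_le_mul_of_nonneg_left (hmono (interior_subset hs) (interior_subset ht) hst) two_pos.le

/-- Solutions of `y' = c y` on an interval are exponentials. -/
theorem eq_exp_smul_of_hasDerivWithinAt {E : Type*} [NormedAddCommGroup E] [NormedSpace ℝ E]
    {a b c : ℝ} {y : ℝ → E} (hy : ∀ t ∈ Icc a b, HasDerivWithinAt y (c • y t) (Icc a b) t) {s t : ℝ}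
    (hs : s ∈ Icc a b) (ht : t ∈ Icc a b) : y t = Real.exp (c * (t - s)) • y s := by
  have h : ∀ r ∈ Icc a b, HasDerivWithinAt (fun r => Real.exp (-(c * r)) • y r) 0 (Icc a b) r := by
    intro r hr
    have h1 : HasDerivAt (fun r : ℝ => Real.exp (-(c * r))) (Real.exp (-(c * r)) * -(c * 1)) r :=
      ((hasDerivAt_id r).const_mul c).neg.exp
    have h2 := h1.hasDerivWithinAt.smul (hy r hr)
    have h3 : Real.exp (-(c * r)) • c • y r + (Real.exp (-(c * r)) * -(c * 1)) • y r = 0 := by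
      rw [smul_smul, ← add_smul]
      simp
    rw [h3] at h2
    exact h2
  have h4 := (convex_Icc a b).norm_image_sub_le_of_norm_hasDerivWithin_le (C := 0) h (by simp) hs ht
  rw [zero_mul, norm_le_zero_iff, sub_eq_zero] at h4
  have h5 := congrArg (fun v => Real.exp (c * t) • v) h4
  simp only [smul_smul, ← Real.exp_add] at h5
  rw [add_neg_cancel, Real.exp_zero, one_smul] at h5
  rw [h5]
  congr 2
  ring

theorem eq_zero_of_integral_sq_eq_zero {X E : Type*} [TopologicalSpace X] [MeasurableSpace X]
    [NormedAddCommGroup E] {μ : Measure X} [μ.IsOpenPosMeasure] {f : X → E} (hf : Continuous f)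
    (hi : Integrable (fun x => ‖f x‖ ^ 2) μ) (h : ∫ x, ‖f x‖ ^ 2 ∂μ = 0) : f = 0 := by
  have h1 := (integral_eq_zero_iff_of_nonneg (fun x => sq_nonneg ‖f x‖) hi).1 h
  have h2 := Continuous.ae_eq_iff_eq μ (hf.norm.pow 2) continuous_zero |>.1 h1
  ext x
  simpa using congrFun h2 x

/-! ### The weak heat equation tested against Sobolev functions. -/

section Kernel

variable {n N : ℕ} {M : Type*} [TopologicalSpace M] [T2Space M] [SecondCountableTopology M]
  [ChartedSpace (Euc n) M] [IsManifold 𝓘(ℝ, Euc n) ∞ M] [MeasurableSpace M] [BorelSpace M]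

/-- The weak form of the heat equation, tested against an element of the Sobolev space. -/
theorem hasDerivWithinAt_integral_inner {g : Metric n M} {φ : M → ℝ}
    (hφ : ContMDiff 𝓘(ℝ, Euc n) 𝓘(ℝ, ℝ) ∞ φ) {a b : ℝ} (hab : a < b) {u : M → ℝ → Euc N}
    (hu : ContMDiffOn (𝓘(ℝ, Euc n).prod 𝓘(ℝ, ℝ)) 𝓘(ℝ, Euc N) ∞
      (fun p : M × ℝ => u p.1 p.2) (univ ×ˢ Icc a b))
    (he : ∀ t ∈ Icc a b, FiniteEnergy g φ fun x => u x t) {C : ℝ}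
    (hC : ∀ t ∈ Icc a b, ∫ x, ‖u x t‖ ^ 2 ∂(weightedVolume g φ) ≤ C ∧
      ∫ x, gradSq g (fun x => u x t) x ∂(weightedVolume g φ) ≤ C)
    (heq : ∀ t ∈ Icc a b, driftLaplacian g φ (fun y => u y t) = fun x => timeDeriv a b u x t)
    {w : M → Euc N} (hw : MemSobolev g φ w) {t : ℝ} (ht : t ∈ Icc a b) :
    HasDerivWithinAt (fun s => ∫ x, inner ℝ (u x s) (w x) ∂(weightedVolume g φ))
      (-∫ x, gradInner g w (fun x => u x t) x ∂(weightedVolume g φ)) (Icc a b) t := by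
  have := isLocallyFiniteMeasure_weightedVolume g hφ.continuous
  obtain ⟨hd, hv⟩ := continuousOn_timeDeriv hab hu
  have hwe := hw.finiteEnergy hφ.continuous
  -- For a test function `ψ` in place of `w`, differentiation under the integral is legitimate. Both
  -- the functions and their derivatives converge uniformly in time, because the errors involve only
  -- norms of `w - ψ`, `u` and `∇u`.
  refine (hasDerivWithinAt_of_approx hab
    (G := fun t => -∫ x, gradInner g w (fun x => u x t) x ∂(weightedVolume g φ))
    fun ε hε => ?_).2 t ht
  -- Approximating `w` to this accuracy makes every Cauchy–Schwarz error at most `ε`; the `+ 1`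
  -- guards against `C = 0`.
  have hδ : 0 < ε / (√C + 1) := by positivity
  obtain ⟨ψ, hψ, hc, hψe, hde, h1, h2⟩ := hw.exists_approx hφ.continuous (pow_pos hδ 2)
  have hprod : ∀ {A B : ℝ}, A ≤ (ε / (√C + 1)) ^ 2 → B ≤ C → √A * √B ≤ ε := by
    intro A B hA hB
    calc √A * √B ≤ ε / (√C + 1) * (√C + 1) := by
          refine mul_le_mul ?_ ((Real.sqrt_le_sqrt hB).trans (by linarith)) (Real.sqrt_nonneg _) hδ.le
          exact (Real.sqrt_le_sqrt hA).trans (Real.sqrt_sq hδ.le).le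
      _ = ε := div_mul_cancel₀ _ (by positivity)
  obtain ⟨hcont, hint⟩ := integral_inner_sub_eq_integral (μ := weightedVolume g φ) hu.continuousOn hv hd
    hψ.continuous hc
  refine ⟨_, _, hcont, hint, fun s hs => ⟨?_, ?_⟩⟩
  · have e1 : ∫ x, inner ℝ (u x s) (w x) ∂(weightedVolume g φ) -
        ∫ x, inner ℝ (u x s) (ψ x) ∂(weightedVolume g φ) =
        ∫ x, inner ℝ (w x - ψ x) (u x s) ∂(weightedVolume g φ) := by
      rw [← integral_sub ((he s hs).inner hwe).1 ((he s hs).inner hψe).1]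
      simp only [← inner_sub_right, real_inner_comm]
    rw [e1]
    exact (hde.inner (he s hs)).2.trans (hprod h1 (hC s hs).1)
  · have hG := integral_inner_driftLaplacian g hφ (he s hs).smooth hψ hc
    rw [heq s hs] at hG
    have e2 : (fun x => inner ℝ (timeDeriv a b u x s) (ψ x)) =
        fun x => inner ℝ (ψ x) (timeDeriv a b u x s) := funext fun x => real_inner_comm _ _
    have e3 : ∫ x, gradInner g (fun x => w x - ψ x) (fun x => u x s) x ∂(weightedVolume g φ) =
        ∫ x, gradInner g w (fun x => u x s) x ∂(weightedVolume g φ) -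
          ∫ x, gradInner g ψ (fun x => u x s) x ∂(weightedVolume g φ) := by
      simp only [gradInner_sub_left g hwe.smooth hψ]
      exact integral_sub (hwe.gradInner (he s hs)).1 (hψe.gradInner (he s hs)).1
    rw [e2, hG, show ∀ A B : ℝ, -A - -B = -(A - B) by intros; ring, ← e3, abs_neg]
    exact (hde.gradInner (he s hs)).2.trans (hprod h2 (hC s hs).2)

end Kernel

/-! ### Derivatives of `I` and `D`, and equality in Cauchy–Schwarz. -/

section Energy

variable {n N : ℕ} {M : Type*} [TopologicalSpace M] [T2Space M] [SecondCountableTopology M]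
  [ChartedSpace (Euc n) M] [IsManifold 𝓘(ℝ, Euc n) ∞ M] [MeasurableSpace M] [BorelSpace M]

/-- The `L²` norm and the Dirichlet energy of a solution: their time derivatives, the convexity of
the former and the Cauchy–Schwarz inequality between them. -/
theorem energy_identities {g : Metric n M} {φ : M → ℝ}
    (hφ : ContMDiff 𝓘(ℝ, Euc n) 𝓘(ℝ, ℝ) ∞ φ) {a b : ℝ} (hab : a < b) {u : M → ℝ → Euc N}
    (hu : ContMDiffOn (𝓘(ℝ, Euc n).prod 𝓘(ℝ, ℝ)) 𝓘(ℝ, Euc N) ∞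
      (fun p : M × ℝ => u p.1 p.2) (univ ×ˢ Icc a b))
    (hW : ∀ t ∈ Icc a b, MemSobolev g φ fun x => u x t)
    (hWt : ∀ t ∈ Icc a b, MemSobolev g φ fun x => timeDeriv a b u x t)
    {C : ℝ} (hC : ∀ t ∈ Icc a b, ∫ x, ‖u x t‖ ^ 2 ∂(weightedVolume g φ) ≤ C ∧
      ∫ x, gradSq g (fun x => u x t) x ∂(weightedVolume g φ) ≤ C)
    (heq : ∀ t ∈ Icc a b, driftLaplacian g φ (fun y => u y t) = fun x => timeDeriv a b u x t) :
    (∀ t ∈ Icc a b, energyD g φ u t =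
      ∫ x, inner ℝ (u x t) (timeDeriv a b u x t) ∂(weightedVolume g φ)) ∧
    (∀ t ∈ Icc a b, HasDerivWithinAt (energyI g φ u) (2 * energyD g φ u t) (Icc a b) t) ∧
    (∀ t ∈ Icc a b, HasDerivWithinAt (energyD g φ u)
      (2 * ∫ x, ‖timeDeriv a b u x t‖ ^ 2 ∂(weightedVolume g φ)) (Icc a b) t) ∧
    (∀ t ∈ Icc a b, energyD g φ u t ^ 2 ≤
      energyI g φ u t * ∫ x, ‖timeDeriv a b u x t‖ ^ 2 ∂(weightedVolume g φ)) ∧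
    ∀ s ∈ Icc a b, ∀ t ∈ Icc a b,
      energyI g φ u ((s + t) / 2) ^ 2 ≤ energyI g φ u s * energyI g φ u t := by
  set μ := weightedVolume g φ with hμ
  have he := fun t ht => (hW t ht).finiteEnergy hφ.continuous
  have het := fun t ht => (hWt t ht).finiteEnergy hφ.continuous
  set f : ℝ → ℝ → ℝ := fun s t => ∫ x, inner ℝ (u x s) (u x t) ∂μ with hf
  set k : ℝ → ℝ → ℝ := fun s t => ∫ x, inner ℝ (u x s) (timeDeriv a b u x t) ∂μ with hk
  set m : ℝ → ℝ → ℝ := fun s t => ∫ x, inner ℝ (timeDeriv a b u x t) (timeDeriv a b u x s) ∂μ with hm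
  have hfs : ∀ s t, f s t = f t s := fun s t => by simp only [hf, real_inner_comm]
  have hfd : ∀ t, f t t = energyI g φ u t := fun t => by
    simp only [hf, real_inner_self_eq_norm_sq, energyI, hμ]
  have hmd : ∀ t, m t t = ∫ x, ‖timeDeriv a b u x t‖ ^ 2 ∂μ := fun t => by
    simp only [hm, real_inner_self_eq_norm_sq]
  have hkg : ∀ s ∈ Icc a b, ∀ t ∈ Icc a b,
      k s t = -∫ x, gradInner g (fun x => u x s) (fun x => u x t) x ∂μ := fun s hs t ht =>
    (hW s hs).integral_inner_driftLaplacian hφ (he t ht) (het t ht) (heq t ht)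
  have hks : ∀ s ∈ Icc a b, ∀ t ∈ Icc a b, k s t = k t s := fun s hs t ht => by
    rw [hkg s hs t ht, hkg t ht s hs]
    simp only [gradInner_comm g (fun x => u x s)]
  have hkd : ∀ t ∈ Icc a b, k t t = energyD g φ u t := fun t ht => hkg t ht t ht
  have hdf : ∀ s ∈ Icc a b, ∀ t ∈ Icc a b, HasDerivWithinAt (fun s => f s t) (k s t) (Icc a b) s := by
    intro s hs t ht
    rw [hks s hs t ht, hkg t ht s hs]
    exact hasDerivWithinAt_integral_inner hφ hab hu he hC heq (hW t ht) hs
  -- Here `u_t(t)` itself serves as the Sobolev test function; Green's formula turns `-∫ ⟨∇u_t(t),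
  -- ∇u(s)⟩ e^{-φ}` into `m s t`.
  have hdk : ∀ s ∈ Icc a b, ∀ t ∈ Icc a b, HasDerivWithinAt (fun s => k s t) (m s t) (Icc a b) s := by
    intro s hs t ht
    have h1 := (hWt t ht).integral_inner_driftLaplacian hφ (he s hs) (het s hs) (heq s hs)
    simp only [hm]
    rw [h1]
    exact hasDerivWithinAt_integral_inner hφ hab hu he hC heq (hWt t ht) hs
  -- The gradient form of `k` is bounded by the Dirichlet energy of `u` alone, so no uniform bound
  -- on `u_t` is needed.
  have hkC : ∀ s ∈ Icc a b, ∀ t ∈ Icc a b, |k s t| ≤ C := by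
    intro s hs t ht
    have hC0 : 0 ≤ C := (integral_nonneg fun x => sq_nonneg ‖u x s‖).trans (hC s hs).1
    rw [hkg s hs t ht, abs_neg]
    refine ((he s hs).gradInner (he t ht)).2.trans ?_
    rw [← Real.mul_self_sqrt hC0]
    exact mul_le_mul (Real.sqrt_le_sqrt (hC s hs).2) (Real.sqrt_le_sqrt (hC t ht).2)
      (Real.sqrt_nonneg _) (Real.sqrt_nonneg _)
  have hfm : ∀ s ∈ Icc a b, ∀ t ∈ Icc a b, f s t = f ((s + t) / 2) ((s + t) / 2) := fun s hs t ht =>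
    eq_midpoint_of_symm hab (fun s _ t _ => hfs s t) hks hdf
      (fun t ht s hs => (hdk s hs t ht).continuousWithinAt) hkC hs ht
  have hkm := deriv_eq_midpoint hfm hks hdf
  have hcs : ∀ {A B X : ℝ}, 0 ≤ A → 0 ≤ B → |X| ≤ √A * √B → X ^ 2 ≤ A * B := fun {A B X} hA hB h => by
    rw [← sq_abs, ← Real.sq_sqrt hA, ← Real.sq_sqrt hB, ← mul_pow]
    exact pow_le_pow_left₀ (abs_nonneg _) h 2
  have hnn : ∀ (v : M → Euc N), 0 ≤ ∫ x, ‖v x‖ ^ 2 ∂μ := fun v => integral_nonneg fun x => sq_nonneg _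
  refine ⟨fun t ht => (hkd t ht).symm, fun t ht => ?_, fun t ht => ?_, fun t ht => ?_,
    fun s hs t ht => ?_⟩
  · rw [← hkd t ht]
    exact (hasDerivWithinAt_diag hfm ht (hdf t ht t ht)).congr (fun s _ => (hfd s).symm) (hfd t).symm
  · rw [← hmd t]
    exact (hasDerivWithinAt_diag hkm ht (hdk t ht t ht)).congr (fun s hs => (hkd s hs).symm)
      (hkd t ht).symm
  · rw [← hkd t ht]
    exact hcs (hnn _) (hnn _) ((he t ht).inner (het t ht)).2
  -- The value of `I` at the midpoint is `f s t`, so log-convexity is Cauchy–Schwarz between `u(s)`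
  -- and `u(t)`.
  · rw [← hfd, ← hfm s hs t ht]
    exact hcs (hnn _) (hnn _) ((he s hs).inner (he t ht)).2

omit [T2Space M] in
/-- The equality case of the Cauchy–Schwarz inequality in the weighted `L²` space. -/
theorem eq_smul_of_integral_inner_sq_eq {g : Metric n M} {φ : M → ℝ} (hφ : Continuous φ) {v w : M → Euc N}
    (hv : FiniteEnergy g φ v) (hw : FiniteEnergy g φ w) {c : ℝ}
    (hpos : 0 < ∫ x, ‖v x‖ ^ 2 ∂(weightedVolume g φ))
    (hc : ∫ x, inner ℝ (v x) (w x) ∂(weightedVolume g φ) =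
      c * ∫ x, ‖v x‖ ^ 2 ∂(weightedVolume g φ))
    (heq : (∫ x, inner ℝ (v x) (w x) ∂(weightedVolume g φ)) ^ 2 =
      (∫ x, ‖v x‖ ^ 2 ∂(weightedVolume g φ)) * ∫ x, ‖w x‖ ^ 2 ∂(weightedVolume g φ)) (x : M) :
    w x = c • v x := by
  have := isOpenPosMeasure_weightedVolume g hφ
  set μ := weightedVolume g φ
  have hexp : ∀ x, ‖w x - c • v x‖ ^ 2 = ‖w x‖ ^ 2 - 2 * c * inner ℝ (v x) (w x) + c ^ 2 * ‖v x‖ ^ 2 := by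
    intro x
    rw [norm_sub_sq_real, inner_smul_right, real_inner_comm, norm_smul, mul_pow, Real.norm_eq_abs, sq_abs]
    ring
  have hi1 : Integrable (fun x => 2 * c * inner ℝ (v x) (w x)) μ := (hv.inner hw).1.const_mul _
  have hi2 : Integrable (fun x => c ^ 2 * ‖v x‖ ^ 2) μ := hv.sq.const_mul _
  have hi3 : Integrable (fun x => ‖w x‖ ^ 2 - 2 * c * inner ℝ (v x) (w x)) μ := hw.sq.sub hi1
  have hi : Integrable (fun x => ‖w x - c • v x‖ ^ 2) μ := by
    simp only [hexp]
    exact hi3.add hi2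
  -- Equality in Cauchy–Schwarz gives `‖w‖² = c² ‖v‖²`, so the expanded square is `c² - 2c² + c² =
  -- 0` times `‖v‖²`.
  have hint : ∫ x, ‖w x - c • v x‖ ^ 2 ∂μ = 0 := by
    simp only [hexp]
    rw [integral_add hi3 hi2, integral_sub hw.sq hi1, integral_const_mul, integral_const_mul, hc]
    rw [hc] at heq
    have : ∫ x, ‖w x‖ ^ 2 ∂μ = c ^ 2 * ∫ x, ‖v x‖ ^ 2 ∂μ :=
      mul_left_cancel₀ hpos.ne' (by rw [← heq]; ring)
    rw [this]
    ring
  have h0 := eq_zero_of_integral_sq_eq_zero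
    (hw.smooth.continuous.sub (hv.smooth.continuous.const_smul c)) hi hint
  exact sub_eq_zero.1 (congrFun h0 x)

end Energy

end DriftHeat

end
-- Monotonicity and rigidity of the parabolic frequency.
theorem theorem1p1 {n N : ℕ} {M : Type*} [TopologicalSpace M] [T2Space M]
    [SecondCountableTopology M] [ChartedSpace (DriftHeat.Euc n) M]
    [IsManifold 𝓘(ℝ, DriftHeat.Euc n) ∞ M] [MeasurableSpace M] [BorelSpace M]
    (g : DriftHeat.Metric n M)
    (φ : M → ℝ) (hφ : ContMDiff 𝓘(ℝ, DriftHeat.Euc n) 𝓘(ℝ, ℝ) ∞ φ)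
    (a b : ℝ) (hab : a < b) (u : M → ℝ → DriftHeat.Euc N)
    -- `u` is smooth on `M × [a, b]` and not identically zero
    (hu : ContMDiffOn (𝓘(ℝ, DriftHeat.Euc n).prod 𝓘(ℝ, ℝ)) 𝓘(ℝ, DriftHeat.Euc N) ∞
      (fun p : M × ℝ => u p.1 p.2) (univ ×ˢ Icc a b))
    (hu0 : ∃ x, ∃ t ∈ Icc a b, u x t ≠ 0)
    -- `u, u_t ∈ W^{1,2}_φ` for each `t`, the Sobolev norm of `u` being bounded on `[a, b]`
    (hW : ∀ t ∈ Icc a b, DriftHeat.MemSobolev g φ (fun x => u x t))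
    (hWt : ∀ t ∈ Icc a b, DriftHeat.MemSobolev g φ (fun x => DriftHeat.timeDeriv a b u x t))
    (hbdd : ∃ C : ℝ≥0, ∀ t ∈ Icc a b, DriftHeat.sobolevSq g φ (fun x => u x t) ≤ C)
    -- `(∂_t - L_φ) u = 0`
    (heq : ∀ t ∈ Icc a b, ∀ x,
      DriftHeat.timeDeriv a b u x t - DriftHeat.driftLaplacian g φ (fun y => u y t) x = 0) :
    -- `I > 0` and `D = ∫ ⟨u, L_φ u⟩ e^{-φ}`
    (∀ t ∈ Icc a b, 0 < DriftHeat.energyI g φ u t) ∧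
    (∀ t ∈ Icc a b, DriftHeat.energyD g φ u t =
      ∫ x, inner ℝ (u x t) (DriftHeat.driftLaplacian g φ (fun y => u y t) x)
        ∂(DriftHeat.weightedVolume g φ)) ∧
    -- `(log I)' = 2 U`
    (∀ t ∈ Icc a b, HasDerivWithinAt (fun s => Real.log (DriftHeat.energyI g φ u s))
      (2 * DriftHeat.frequency g φ u t) (Icc a b) t) ∧
    -- `log I` is convex
    ConvexOn ℝ (Icc a b) (fun s => Real.log (DriftHeat.energyI g φ u s)) ∧
    -- `U' ≥ 0`, and `U` is nondecreasing
    (∀ t ∈ Icc a b, ∃ U' : ℝ, 0 ≤ U' ∧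
      HasDerivWithinAt (DriftHeat.frequency g φ u) U' (Icc a b) t) ∧
    MonotoneOn (DriftHeat.frequency g φ u) (Icc a b) ∧
    -- if `U` is constant, `u` is an exponential in time times an eigenfunction
    (∀ c : ℝ, (∀ t ∈ Icc a b, DriftHeat.frequency g φ u t = c) →
      (∀ s ∈ Icc a b, ∀ t ∈ Icc a b, ∀ x, u x t = Real.exp (c * (t - s)) • u x s) ∧
      (∀ s ∈ Icc a b, DriftHeat.IsEigenfunction g φ (fun x => u x s) (-c))) := by

  have heq' : ∀ t ∈ Icc a b, DriftHeat.driftLaplacian g φ (fun y => u y t) =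
      fun x => DriftHeat.timeDeriv a b u x t := fun t ht =>
    funext fun x => (sub_eq_zero.1 (heq t ht x)).symm
  obtain ⟨C, hC⟩ := hbdd
  have hC' : ∀ t ∈ Icc a b, ∫ x, ‖u x t‖ ^ 2 ∂(DriftHeat.weightedVolume g φ) ≤ C ∧
      ∫ x, DriftHeat.gradSq g (fun x => u x t) x ∂(DriftHeat.weightedVolume g φ) ≤ C := by
    intro t ht
    obtain ⟨-, h1, h2⟩ := DriftHeat.finiteEnergy_of_sobolevSq_lt_top (hW t ht).1
      ((hC t ht).trans_lt ENNReal.coe_lt_top)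
    exact ⟨ENNReal.ofReal_le_coe.1 (h1.trans (hC t ht)), ENNReal.ofReal_le_coe.1 (h2.trans (hC t ht))⟩
  have he := fun t ht => (hW t ht).finiteEnergy hφ.continuous
  have het := fun t ht => (hWt t ht).finiteEnergy hφ.continuous
  obtain ⟨hD, hI', hD', hcs, hmid⟩ := DriftHeat.energy_identities hφ hab hu hW hWt hC' heq'
  have hpos : ∀ t ∈ Icc a b, 0 < DriftHeat.energyI g φ u t := by
    obtain ⟨x₀, t₀, ht₀, hne⟩ := hu0
    have := DriftHeat.isOpenPosMeasure_weightedVolume g hφ.continuous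
    refine DriftHeat.pos_of_sq_midpoint_le (fun t ht => (hI' t ht).continuousWithinAt)
      (fun t _ => integral_nonneg fun x => sq_nonneg _) hmid ht₀ fun h => hne ?_
    exact congrFun (DriftHeat.eq_zero_of_integral_sq_eq_zero (he t₀ ht₀).smooth.continuous
      (he t₀ ht₀).sq h) x₀
  obtain ⟨hlog, hU, hmono, hconv⟩ := DriftHeat.frequency_monotone hpos hI' hD' hcs
  refine ⟨hpos, fun t ht => ?_, hlog, hconv, fun t ht => ⟨_, ?_, hU t ht⟩, hmono, fun c hc => ?_⟩
  · rw [hD t ht, heq' t ht]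
  · exact div_nonneg (by linarith [hcs t ht]) (sq_nonneg _)
  -- A constant frequency has `U' = 0`, which is equality in `D² ≤ I E`; hence `u_t` is a multiple
  -- of `u`, with factor `D / I = c`.
  have hut : ∀ t ∈ Icc a b, ∀ x, DriftHeat.timeDeriv a b u x t = c • u x t := by
    intro t ht
    have h0 : HasDerivWithinAt (fun s => DriftHeat.energyD g φ u s / DriftHeat.energyI g φ u s) 0
        (Icc a b) t := (hasDerivWithinAt_const t (Icc a b) c).congr hc (hc t ht)
    have h1 := (uniqueDiffOn_Icc hab t ht).eq_deriv _ (hU t ht) h0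
    have h2 := (div_eq_zero_iff.1 h1).resolve_right (pow_ne_zero 2 (hpos t ht).ne')
    have h3 : DriftHeat.energyD g φ u t = c * DriftHeat.energyI g φ u t :=
      (div_eq_iff (hpos t ht).ne').1 (hc t ht)
    refine DriftHeat.eq_smul_of_integral_inner_sq_eq hφ.continuous (he t ht) (het t ht) (hpos t ht) ?_ ?_
    · rw [← hD t ht]
      exact h3
    · rw [← hD t ht]
      have h4 : DriftHeat.energyI g φ u t = ∫ x, ‖u x t‖ ^ 2 ∂(DriftHeat.weightedVolume g φ) := rfl
      rw [← h4]
      linarith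
  refine ⟨fun s hs t ht x => ?_, fun s hs => ⟨fun h => ?_, fun x => ?_⟩⟩
  -- At each fixed `x` the equation `u_t = c u` is a linear ODE in time.
  · refine DriftHeat.eq_exp_smul_of_hasDerivWithinAt (y := u x) (fun r hr => ?_) hs ht
    rw [← hut r hr x]
    exact (DriftHeat.continuousOn_timeDeriv hab hu).1 x r hr
  · refine (hpos s hs).ne' ?_
    simp only [DriftHeat.energyI, congrFun h, Pi.zero_apply, norm_zero]
    simp
  · rw [heq' s hs]
    simp only [hut s hs x, neg_smul, neg_neg]
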